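/- **Setting.** A tensor network is a hypergraph $G=(V,E)$ whose vertices are tensors and whose hyperedges $e$ are dimensions with integer sizes $s(e)\ge 1$; an *uncontracted* hyperedge is one with a dangling end, and a contracted one is adjacent to at least two tensors. Put $w(e)=\log s(e)$. For disjoint $A,B\subseteq V$ let $E(A,B)$ be the set of hyperedges adjacent to both $A$ and $B$, let $E(A)$ consist of $E(A,V\setminus A)$ and the uncontracted hyperedges adjacent only to $A$, and let $\mathrm{cut}(A)=w(E(A))$, $\mathrm{cut}(A,B)=w(E(A,B))$. Contracting the outputs of $A$ and $B$ costs $\exp(\mathrm{cut}(A)+\mathrm{cut}(B)-\mathrm{cut}(A,B))$ and *contracts dimensions of total size* $\prod_{e\in E(A,B)\setminus E(A\cup B)}s(e)$. A contraction tree is a rooted binary tree whose leaves are the tensors, each occurring once; its cost is the sum of the costs of its contractions. The data are a tensor network $G_D$ on $V_D$, $N=|V_D|$, a set $\bar E$ of uncontracted hyperedges *to be sketched*, each adjacent to exactly one tensor, and a contraction tree $T_0$ of $G_D$. An embedding $G_E$ is a tensor network on $N_E$ tensors $V_E$ that is a graph (each uncontracted edge is adjacent to one tensor and each contracted edge to two),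 together with an attachment of each $e\in\bar E$ to one tensor of $V_E$; in the overall network $G=(G_D,G_E)$ the edge $e$ connects its data tensor with that embedding tensor. A contraction tree $T_B$ of $G$ is *constrained on* $T_0$ if for each contraction $(A,B)$ of $T_0$ it has a contraction $(\hat A,\hat B)$ with $\hat A\cap V_D=A$ and $\hat B\cap V_D=B$ (contractions being unordered pairs). Fix constants $0<c_0\le c_1\le c_2$. For $\epsilon>0$ and $0<\delta<1$ put $K=\log(1/\delta)/\epsilon^2$. An embedding belongs to $\mathcal G^{(\epsilon,\delta)}$ if * its tensors can be ordered so that for each tensor the product of the sizes of its output dimensions and of its dimensions shared with later tensors is at least $c_0N_EK$, and * it has exactly one output dimension (uncontracted edge not in $\bar E$), whose size, the sketch size, lies between $c_1N_EK$ and $c_2N_EK$. The *tree embedding* of sketch size $m$ for $T_0$ has one tensor $z_W$ for each vertex $W$ of $T_0$: an embedding matrix $z_{\{v\}}$ for each data tensor $v$, to which the sketched edge of $v$ is attached, and one tensor $z_{U\cup V}$ for each contraction $(U,V)$ of $T_0$. For each vertex $W$ of $T_0$ it has one edge of size $m$ from $z_W$ to $z_{W'}$, where $W'$ is the parent of $W$;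 for the root this edge is the output. Its sketching contraction tree contracts each $v$ with $z_{\{v\}}$ and replaces each contraction $(U,V)$ of $T_0$ by $((\hat U,\hat V),z_{U\cup V})$, where $\hat U,\hat V$ are the already sketched $U,V$. **Theorem.** There is a constant $C>0$, depending only on $c_0,c_1,c_2$, such that the following holds for all such data, all $\epsilon>0$ and $0<\delta<1$, and all integers $m$ with $c_1(2N-1)K\le m\le c_2(2N-1)K$. Suppose that each edge to be sketched has size greater than $m$, that each data tensor is adjacent to an edge to be sketched, and that each contraction in $T_0$ contracts dimensions of total size at least $m$. Then: 1. the tree embedding of sketch size $m$ has $2N-1$ tensors, its contracted edges form a tree without parallel edges, and it belongs to $\mathcal G^{(\epsilon,\delta)}$ with sketch size $m$; its sketching contraction tree is a contraction tree of the overall network constrained on $T_0$; 2. the cost of its sketching contraction tree is at most $C$ times the cost of $T_B$, for every embedding $G_E\in\mathcal G^{(\epsilon,\delta)}$ whose sketch size is at least $c_1NK$ (in particular, every one with sketch size $m$) and every contraction tree $T_B$ of $(G_D,G_E)$ constrained on $T_0$. Thus sketching with the tree embedding attains, up to a constant factor, the minimum of the contraction cost over all these embeddings and all contraction trees constrained on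 $T_0$. -/

import Mathlib

/-- A tensor diagram `G = (V, E, w)`: an undirected hypergraph whose vertices are tensors and whose
hyperedges are dimensions. `ends e` is the set of tensors having the dimension `e`;
`uncontracted` is the set of hyperedges that have a dangling end; `size e` is the size of `e`. -/
structure TensorNetwork (V E : Type*) where
  ends : E → Finset V
  uncontracted : Finset E
  size : E → ℕ

namespace TensorNetwork

/-- Sizes are positive, every hyperedge is adjacent to a tensor, and a hyperedge
without dangling end is adjacent to at least two tensors. -/
structure IsProper {V E : Type*} (G : TensorNetwork V E) : Prop where
  size_pos : ∀ e, 1 ≤ G.size e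
  ends_nonempty : ∀ e, (G.ends e).Nonempty
  two_le_of_contracted : ∀ e, e ∉ G.uncontracted → 2 ≤ (G.ends e).card

/-- All hyperedges are edges: an uncontracted one is adjacent to one vertex, a contracted one
to two. Sizes are positive. -/
structure IsGraph {V E : Type*} (G : TensorNetwork V E) : Prop where
  size_pos : ∀ e, 1 ≤ G.size e
  card_uncontracted : ∀ e, e ∈ G.uncontracted → (G.ends e).card = 1
  card_contracted : ∀ e, e ∉ G.uncontracted → (G.ends e).card = 2

variable {V E : Type*} [Fintype V] [DecidableEq V] [Fintype E] [DecidableEq E]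

/-- `w(e)`, the natural logarithm of the size of `e`. -/
noncomputable def weight (G : TensorNetwork V E) (e : E) : ℝ := Real.log (G.size e)

/-- `E(A, B)`: hyperedges adjacent to both `A` and `B`. -/
def edgesBetween (G : TensorNetwork V E) (A B : Finset V) : Finset E :=
  Finset.univ.filter fun e => (G.ends e ∩ A).Nonempty ∧ (G.ends e ∩ B).Nonempty

/-- `E(A, *)`: uncontracted hyperedges adjacent only to `A`. -/
def edgesDangling (G : TensorNetwork V E) (A : Finset V) : Finset E :=
  G.uncontracted.filter fun e => G.ends e ⊆ A

/-- `E(A) = E(A, V \ A) ∪ E(A, *)`: the dimensions of the contraction output of `A`. -/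
def edgesOut (G : TensorNetwork V E) (A : Finset V) : Finset E :=
  G.edgesBetween A Aᶜ ∪ G.edgesDangling A

/-- `cut_G(A)`. -/
noncomputable def cut (G : TensorNetwork V E) (A : Finset V) : ℝ :=
  ∑ e ∈ G.edgesOut A, G.weight e

/-- `cut_G(A, B)`. -/
noncomputable def cutBetween (G : TensorNetwork V E) (A B : Finset V) : ℝ :=
  ∑ e ∈ G.edgesBetween A B, G.weight e

/-- Cost of contracting the contraction outputs of `A` and `B` as dense tensors (with classical
matrix multiplication): `exp(cut(A) + cut(B) - cut(A, B))`. -/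
noncomputable def contractionCost (G : TensorNetwork V E) (A B : Finset V) : ℝ :=
  Real.exp (G.cut A + G.cut B - G.cutBetween A B)

/-- Total size of the dimensions that disappear when (the outputs of) `A` and `B` are
contracted: those shared by `A` and `B` that are not dimensions of the output of `A ∪ B`. -/
def contractedSize (G : TensorNetwork V E) (A B : Finset V) : ℕ :=
  ∏ e ∈ G.edgesBetween A B \ G.edgesOut (A ∪ B), G.size e

end TensorNetwork

/-- Rooted binary trees with leaves labelled by tensors. -/
inductive ContractionTree (V : Type*) where
  | leaf (v : V) : ContractionTree V
  | node (l r : ContractionTree V) : ContractionTree V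

namespace ContractionTree

/-- The tensors at the leaves. -/
def leaves {V : Type*} : ContractionTree V → List V
  | leaf v => [v]
  | node l r => l.leaves ++ r.leaves

/-- A tree fully contracts a network on `V` when each tensor is at exactly one leaf; equivalently,
leaves are singletons, the root is `V`, and siblings are disjoint. -/
structure IsFull {V : Type*} (T : ContractionTree V) : Prop where
  nodup : T.leaves.Nodup
  mem_leaves : ∀ v, v ∈ T.leaves

variable {V : Type*} [DecidableEq V]

/-- The subset of `V` represented by the root. -/
def verts : ContractionTree V → Finset V
  | leaf v => {v}
  | node l r => l.verts ∪ r.verts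

/-- The subsets of `V` represented by the vertices of the tree. -/
def nodes : ContractionTree V → Finset (Finset V)
  | leaf v => {{v}}
  | node l r => insert (l.verts ∪ r.verts) (l.nodes ∪ r.nodes)

/-- The contractions `(A, B)` performed by the tree, one for each internal vertex. -/
def contractions : ContractionTree V → List (Finset V × Finset V)
  | leaf _ => []
  | node l r => (l.verts, r.verts) :: (l.contractions ++ r.contractions)

/-- The vertex `X` of the tree is the parent of the vertex `W`. -/
def IsParent (T : ContractionTree V) (X W : Finset V) : Prop :=
  ∃ p ∈ T.contractions, (p.1 = W ∨ p.2 = W) ∧ X = p.1 ∪ p.2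

instance (T : ContractionTree V) (X W : Finset V) : Decidable (T.IsParent X W) := by
  unfold IsParent; infer_instance

/-- The cost of a contraction tree: the sum of the costs of its contractions. -/
noncomputable def cost {E : Type*} [Fintype V] [Fintype E] [DecidableEq E]
    (T : ContractionTree V) (G : TensorNetwork V E) : ℝ :=
  (T.contractions.map fun p => G.contractionCost p.1 p.2).sum

theorem singleton_mem_nodes {v : V} : ∀ {T : ContractionTree V}, v ∈ T.leaves → {v} ∈ T.nodes
  | leaf u, h => by
      simp only [leaves, List.mem_singleton] at h
      simp [nodes, h]
  | node l r, h => by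
      simp only [leaves, List.mem_append] at h
      simp only [nodes, Finset.mem_insert, Finset.mem_union]
      rcases h with h | h
      · exact Or.inr (Or.inl (singleton_mem_nodes h))
      · exact Or.inr (Or.inr (singleton_mem_nodes h))

/-- A contraction tree `TB` of a network on `VD ⊕ VE` (data and embedding tensors) is constrained
on the contraction tree `T₀` of the data: each contraction `(A, B)` of `T₀` is matched by a
contraction `(A', B')` of `TB` with `A' ∩ VD = A` and `B' ∩ VD = B`. Contractions are
unordered pairs. -/
def ConstrainedOn {VD VE : Type*} [DecidableEq VD] [DecidableEq VE]
    (TB : ContractionTree (VD ⊕ VE)) (T₀ : ContractionTree VD) : Prop :=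
  ∀ p ∈ T₀.contractions, ∃ q ∈ TB.contractions,
    (q.1.toLeft = p.1 ∧ q.2.toLeft = p.2) ∨ (q.1.toLeft = p.2 ∧ q.2.toLeft = p.1)

/-- Given a tree on data tensors and an embedding tensor `z W` for each vertex `W` of the tree:
each data tensor `v` is first contracted with `z {v}`, and each contraction `(U, V)` is replaced by
`((U', V'), z (U ∪ V))`, where `U'`, `V'` are the already sketched `U`, `V`. -/
def sketch {VE : Type*} : (T : ContractionTree V) → ((W : Finset V) → W ∈ T.nodes → VE) →
    ContractionTree (V ⊕ VE)
  | leaf v, z => node (leaf (Sum.inl v)) (leaf (Sum.inr (z {v} (by simp [nodes]))))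
  | node l r, z =>
      node
        (node (l.sketch fun W h => z W (by simp [nodes, h]))
          (r.sketch fun W h => z W (by simp [nodes, h])))
        (leaf (Sum.inr (z (l.verts ∪ r.verts) (by simp [nodes]))))

end ContractionTree

/-- The given data: a tensor network `G_D`, its set of (uncontracted) edges to be sketched, each
adjacent to only one tensor, and a contraction tree `T₀` of `G_D`. -/
structure SketchingInput (VD ED : Type*) where
  net : TensorNetwork VD ED
  proper : net.IsProper
  sketched : Finset ED
  sketched_uncontracted : sketched ⊆ net.uncontracted
  card_ends_of_sketched : ∀ e ∈ sketched, (net.ends e).card = 1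
  tree : ContractionTree VD
  tree_full : tree.IsFull

/-- A tensor network embedding for the edges to be sketched. `attach e` is the embedding tensor
to which the sketched edge `e` is connected; `net` has the embedding tensors as vertices and all
other edges of the embedding as edges, so that `net.uncontracted` is the set of output
(row) dimensions. -/
structure Embedding {ED : Type*} (sketched : Finset ED) (VE EE : Type*) where
  attach : {e // e ∈ sketched} → VE
  net : TensorNetwork VE EE

namespace Embedding

variable {ED : Type*} {sketched : Finset ED} {VE EE : Type*}
  [Fintype VE] [DecidableEq VE] [Fintype EE] [DecidableEq EE]

/-- The output sketch size, the product of the sizes of the output dimensions. -/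
def sketchSize (S : Embedding sketched VE EE) : ℕ :=
  ∏ f ∈ S.net.uncontracted, S.net.size f

/-- For an ordering of the embedding tensors: the row size of the matricization of the tensor at
`v` that has the output dimensions and the dimensions connected to later tensors as rows. -/
def rowSize (S : Embedding sketched VE EE) (ord : VE ≃ Fin (Fintype.card VE)) (v : VE) : ℕ :=
  ∏ f ∈ Finset.univ.filter (fun f => v ∈ S.net.ends f ∧
    (f ∈ S.net.uncontracted ∨ ∃ u ∈ S.net.ends f, ord v < ord u)), S.net.size f

/-- The class of embeddings over which one optimizes: graph embeddings with
* a linearization in which each matricized tensor has row size `Ω(N_E log(1/δ)/ε²)`,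
  with constant `c₀`;
* only one output dimension, of size `Θ(N_E log(1/δ)/ε²)`, with constants `c₁` and `c₂`.
Here `N_E` is the number of embedding tensors. -/
structure IsAdmissible (S : Embedding sketched VE EE) (c₀ c₁ c₂ ε δ : ℝ) : Prop where
  graph : S.net.IsGraph
  linearization : ∃ ord : VE ≃ Fin (Fintype.card VE), ∀ v,
    c₀ * (Fintype.card VE * (Real.log (1 / δ) / ε ^ 2)) ≤ S.rowSize ord v
  one_output : S.net.uncontracted.card = 1
  sketchSize_ge : c₁ * (Fintype.card VE * (Real.log (1 / δ) / ε ^ 2)) ≤ S.sketchSize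
  sketchSize_le : S.sketchSize ≤ c₂ * (Fintype.card VE * (Real.log (1 / δ) / ε ^ 2))

/-- The graph on the embedding tensors formed by the contracted edges. -/
def toSimpleGraph (S : Embedding sketched VE EE) : SimpleGraph VE :=
  SimpleGraph.fromRel fun u v =>
    ∃ f, f ∉ S.net.uncontracted ∧ u ∈ S.net.ends f ∧ v ∈ S.net.ends f

/-- Tree tensor network embeddings: the contracted edges form a tree, without parallel edges. -/
structure IsTree (S : Embedding sketched VE EE) : Prop where
  graph : S.net.IsGraph
  tree : S.toSimpleGraph.IsTree
  no_parallel : ∀ f g, f ∉ S.net.uncontracted → g ∉ S.net.uncontracted →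
    S.net.ends f = S.net.ends g → f = g

end Embedding

namespace SketchingInput

variable {VD ED : Type*} [DecidableEq VD]

/-- The overall network `G = (G_D, G_E)`: each sketched edge now connects its data tensor with the
embedding tensor to which it is attached. -/
def combined {VE EE : Type*} [DecidableEq ED] [DecidableEq VE]
    (P : SketchingInput VD ED) (S : Embedding P.sketched VE EE) :
    TensorNetwork (VD ⊕ VE) (ED ⊕ EE) where
  ends
    | Sum.inl e => (P.net.ends e).disjSum
        (if h : e ∈ P.sketched then {S.attach ⟨e, h⟩} else ∅)
    | Sum.inr f => (∅ : Finset VD).disjSum (S.net.ends f)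
  uncontracted := (P.net.uncontracted \ P.sketched).disjSum S.net.uncontracted
  size := Sum.elim P.net.size S.net.size

/-- The vertices of the data contraction tree; they index the tensors of the tree embedding. -/
abbrev TreeNode (P : SketchingInput VD ED) : Type _ := {W : Finset VD // W ∈ P.tree.nodes}

theorem ends_mem_nodes (P : SketchingInput VD ED) (e : {e // e ∈ P.sketched}) :
    P.net.ends e.1 ∈ P.tree.nodes := by
  obtain ⟨v, hv⟩ := Finset.card_eq_one.1 (P.card_ends_of_sketched e.1 e.2)
  rw [hv]
  exact ContractionTree.singleton_mem_nodes (P.tree_full.mem_leaves v)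

/-- The tree embedding with sketch size `m`. It has a tensor for each data tensor `v`
(the vertex `{v}` of `T₀`), to which the sketched edge of `v` is attached, and a tensor for each
contraction of `T₀` (the vertex `U ∪ V` for the contraction `(U, V)`). For each vertex `W` of `T₀`
it has an edge of size `m`, also named `W`, from the tensor at `W` to the tensor at the parent
of `W`; for the root this edge is the output. -/
def treeEmbedding (P : SketchingInput VD ED) (m : ℕ) :
    Embedding P.sketched P.TreeNode P.TreeNode where
  attach e := ⟨P.net.ends e.1, P.ends_mem_nodes e⟩
  net :=
    { ends := fun W => Finset.univ.filter fun X => X = W ∨ P.tree.IsParent X.1 W.1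
      uncontracted := Finset.univ.filter fun W => W.1 = P.tree.verts
      size := fun _ => m }

/-- The contraction tree that sketches with the tree embedding: each data tensor is contracted
with its embedding matrix, and each contraction `(U, V)` of `T₀` becomes `((U', V'), z)` for the
sketched `U'`, `V'` and the embedding tensor `z` of that contraction. -/
def treeSketch (P : SketchingInput VD ED) : ContractionTree (VD ⊕ P.TreeNode) :=
  P.tree.sketch fun W h => ⟨W, h⟩

end SketchingInput

/-! For disjoint operands the cost of a contraction is the product of the sizes of all dimensions of
the two outputs (`contractionCost_eq_prod`), so costs are compared by comparing sets of dimensions.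
Let t(v) be the product of all dimension sizes of the data tensor v, and u(A, B) the product over
the dimensions not to be sketched in the contraction (A, B) of T₀.

Upper bound (`sketch_cost_le`): a sketched subtree has only its unsketched data dimensions and one
edge of size m. Hence sketching v costs at most m t(v), and joining two sketched subtrees at most m²
u(A, B). Applying z involves three edges of size m, but by then the dimensions shared only by A and
B, of total size at least m, are gone; this again gives m² u(A, B).

Lower bound: let b be a common lower bound for row sizes and sketched dimensions. Every nonempty set
X of tensors has output dimensions outside the unsketched data of product at least b
(`exists_external`): the row dimensions of the last embedding tensor in X all leave X, and if X has
no embedding tensor, then a sketched edge does. For disjoint operands these groups are disjoint,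
since in a graph an edge is a row dimension of one end only. So the contraction matching (A, B)
costs at least b² u(A, B), and one that consumes the leaf v at least b t(v). The matching is
injective, and a contraction consumes at most two leaves.

With b = κm, where κ depends only on c₀, c₁, c₂, the bounds differ by the factor 2/κ + 2/κ². -/

set_option linter.unusedSectionVars false

/-! ### Combinatorics of contraction trees with distinct leaves -/

namespace ContractionTree

section
variable {V : Type*} [DecidableEq V]

theorem mem_verts {T : ContractionTree V} {v : V} : v ∈ T.verts ↔ v ∈ T.leaves := by
  induction T with
  | leaf u => simp [verts, leaves]
  | node l r hl hr => simp [verts, leaves, hl, hr]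

theorem verts_nonempty (T : ContractionTree V) : T.verts.Nonempty := by
  induction T with
  | leaf u => simp [verts]
  | node l r hl hr => exact hl.mono Finset.subset_union_left

theorem verts_mem_nodes (T : ContractionTree V) : T.verts ∈ T.nodes := by
  cases T <;> simp [verts, nodes]

theorem subset_verts_of_mem_nodes {T : ContractionTree V} {W : Finset V} (h : W ∈ T.nodes) :
    W ⊆ T.verts := by
  induction T with
  | leaf u => simp_all [verts, nodes]
  | node l r hl hr =>
    simp only [nodes, Finset.mem_insert, Finset.mem_union] at h
    rcases h with rfl | h | h
    · rfl
    · exact (hl h).trans Finset.subset_union_left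
    · exact (hr h).trans Finset.subset_union_right

theorem nonempty_of_mem_nodes {T : ContractionTree V} {W : Finset V} (h : W ∈ T.nodes) :
    W.Nonempty := by
  induction T with
  | leaf u => simp_all [nodes]
  | node l r hl hr =>
    simp only [nodes, Finset.mem_insert, Finset.mem_union] at h
    rcases h with rfl | h | h
    · exact l.verts_nonempty.mono Finset.subset_union_left
    · exact hl h
    · exact hr h

theorem fst_mem_nodes {T : ContractionTree V} {p : Finset V × Finset V}
    (h : p ∈ T.contractions) : p.1 ∈ T.nodes := by
  induction T with
  | leaf u => simp [contractions] at h
  | node l r hl hr =>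
    simp only [contractions, List.mem_cons, List.mem_append] at h
    simp only [nodes, Finset.mem_insert, Finset.mem_union]
    rcases h with rfl | h | h
    · exact .inr (.inl l.verts_mem_nodes)
    · exact .inr (.inl (hl h))
    · exact .inr (.inr (hr h))

theorem snd_mem_nodes {T : ContractionTree V} {p : Finset V × Finset V}
    (h : p ∈ T.contractions) : p.2 ∈ T.nodes := by
  induction T with
  | leaf u => simp [contractions] at h
  | node l r hl hr =>
    simp only [contractions, List.mem_cons, List.mem_append] at h
    simp only [nodes, Finset.mem_insert, Finset.mem_union]
    rcases h with rfl | h | h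
    · exact .inr (.inr r.verts_mem_nodes)
    · exact .inr (.inl (hl h))
    · exact .inr (.inr (hr h))

theorem union_mem_nodes {T : ContractionTree V} {p : Finset V × Finset V}
    (h : p ∈ T.contractions) : p.1 ∪ p.2 ∈ T.nodes := by
  induction T with
  | leaf u => simp [contractions] at h
  | node l r hl hr =>
    simp only [contractions, List.mem_cons, List.mem_append] at h
    simp only [nodes, Finset.mem_insert, Finset.mem_union]
    rcases h with rfl | h | h
    · exact .inl rfl
    · exact .inr (.inl (hl h))
    · exact .inr (.inr (hr h))

theorem disjoint_verts {l r : ContractionTree V} (h : (node l r).leaves.Nodup) :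
    Disjoint l.verts r.verts := by
  rw [Finset.disjoint_left]
  intro v hl hr
  exact (List.nodup_append.1 h).2.2 v (mem_verts.1 hl) v (mem_verts.1 hr) rfl

theorem disjoint_of_mem_contractions {T : ContractionTree V} (hT : T.leaves.Nodup)
    {p : Finset V × Finset V} (h : p ∈ T.contractions) : Disjoint p.1 p.2 := by
  induction T with
  | leaf u => simp [contractions] at h
  | node l r hl hr =>
    simp only [contractions, List.mem_cons, List.mem_append] at h
    rcases h with rfl | h | h
    · exact disjoint_verts hT
    · exact hl (List.nodup_append.1 hT).1 h
    · exact hr (List.nodup_append.1 hT).2.1 h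

/-- Every vertex of a tree is a leaf or the union of a contraction. -/
theorem mem_nodes_iff {T : ContractionTree V} {W : Finset V} :
    W ∈ T.nodes ↔ (∃ v ∈ T.leaves, W = {v}) ∨ ∃ p ∈ T.contractions, W = p.1 ∪ p.2 := by
  induction T with
  | leaf u => simp [nodes, leaves, contractions]
  | node l r hl hr =>
    simp only [nodes, Finset.mem_insert, Finset.mem_union, hl, hr, leaves, contractions,
      List.mem_append, List.mem_cons]
    constructor
    · rintro (rfl | (⟨v, hv, rfl⟩ | ⟨p, hp, rfl⟩) | (⟨v, hv, rfl⟩ | ⟨p, hp, rfl⟩))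
      · exact .inr ⟨_, .inl rfl, rfl⟩
      · exact .inl ⟨v, .inl hv, rfl⟩
      · exact .inr ⟨p, .inr (.inl hp), rfl⟩
      · exact .inl ⟨v, .inr hv, rfl⟩
      · exact .inr ⟨p, .inr (.inr hp), rfl⟩
    · rintro (⟨v, hv | hv, rfl⟩ | ⟨p, rfl | hp | hp, rfl⟩)
      · exact .inr (.inl (.inl ⟨v, hv, rfl⟩))
      · exact .inr (.inr (.inl ⟨v, hv, rfl⟩))
      · exact .inl rfl
      · exact .inr (.inl (.inr ⟨p, hp, rfl⟩))
      · exact .inr (.inr (.inr ⟨p, hp, rfl⟩))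

theorem not_mem_nodes_of_disjoint {T : ContractionTree V} {A W : Finset V}
    (h : Disjoint T.verts A) (hA : W ⊆ A) : W ∉ T.nodes := fun hW => by
  obtain ⟨x, hx⟩ := nonempty_of_mem_nodes hW
  exact Finset.disjoint_left.1 h (subset_verts_of_mem_nodes hW hx) (hA hx)

theorem union_verts_not_mem_left {l r : ContractionTree V} (h : (node l r).leaves.Nodup) :
    l.verts ∪ r.verts ∉ l.nodes := fun hW => by
  obtain ⟨x, hx⟩ := r.verts_nonempty
  exact Finset.disjoint_left.1 (disjoint_verts h)
    (subset_verts_of_mem_nodes hW (Finset.mem_union_right _ hx)) hx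

theorem union_verts_not_mem_right {l r : ContractionTree V} (h : (node l r).leaves.Nodup) :
    l.verts ∪ r.verts ∉ r.nodes := fun hW => by
  obtain ⟨x, hx⟩ := l.verts_nonempty
  exact Finset.disjoint_left.1 (disjoint_verts h) hx
    (subset_verts_of_mem_nodes hW (Finset.mem_union_left _ hx))

theorem disjoint_nodes {l r : ContractionTree V} (h : (node l r).leaves.Nodup) :
    Disjoint l.nodes r.nodes :=
  Finset.disjoint_right.2 fun _ hW =>
    not_mem_nodes_of_disjoint (disjoint_verts h) (subset_verts_of_mem_nodes hW)

/-- Vertices are nonempty and the two subtrees live on disjoint tensor sets, so no set occurs on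
both sides, and the root lies in neither subtree. Hence a contraction is determined by its union. -/
theorem nodup_map_union {T : ContractionTree V} (hT : T.leaves.Nodup) :
    (T.contractions.map fun p => p.1 ∪ p.2).Nodup := by
  induction T with
  | leaf u => simp [contractions]
  | node l r hl hr =>
    have hl' := hl (List.nodup_append.1 hT).1
    have hr' := hr (List.nodup_append.1 hT).2.1
    rw [contractions, List.map_cons, List.nodup_cons, List.map_append, List.nodup_append]
    refine ⟨?_, hl', hr', ?_⟩
    · rw [List.mem_append]
      rintro (h | h) <;> obtain ⟨p, hp, he⟩ := List.mem_map.1 h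
      · exact union_verts_not_mem_left hT (he ▸ union_mem_nodes hp)
      · exact union_verts_not_mem_right hT (he ▸ union_mem_nodes hp)
    · intro a ha b hb hab
      obtain ⟨p, hp, rfl⟩ := List.mem_map.1 ha
      obtain ⟨q, hq, rfl⟩ := List.mem_map.1 hb
      exact Finset.disjoint_left.1 (disjoint_nodes hT) (union_mem_nodes hp)
        (hab ▸ union_mem_nodes hq)

theorem nodup_contractions {T : ContractionTree V} (hT : T.leaves.Nodup) :
    T.contractions.Nodup := (nodup_map_union hT).of_map _

theorem contraction_eq_of_union_eq {T : ContractionTree V} (hT : T.leaves.Nodup)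
    {p q : Finset V × Finset V} (hp : p ∈ T.contractions) (hq : q ∈ T.contractions)
    (h : p.1 ∪ p.2 = q.1 ∪ q.2) : p = q :=
  List.inj_on_of_nodup_map (nodup_map_union hT) hp hq h

theorem card_nodes {T : ContractionTree V} (hT : T.leaves.Nodup) :
    T.nodes.card + 1 = 2 * T.leaves.length := by
  induction T with
  | leaf u => simp [nodes, leaves]
  | node l r hl hr =>
    have hl' := hl (List.nodup_append.1 hT).1
    have hr' := hr (List.nodup_append.1 hT).2.1
    rw [nodes, Finset.card_insert_of_notMem, Finset.card_union_of_disjoint (disjoint_nodes hT),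
      leaves, List.length_append]
    · omega
    · rw [Finset.mem_union]
      exact fun h => h.elim (union_verts_not_mem_left hT) (union_verts_not_mem_right hT)

theorem exists_isParent {T : ContractionTree V} {W : Finset V} (hW : W ∈ T.nodes)
    (hne : W ≠ T.verts) : ∃ X, T.IsParent X W := by
  induction T with
  | leaf u => simp_all [nodes, verts]
  | node l r hl hr =>
    simp only [nodes, Finset.mem_insert, Finset.mem_union] at hW
    rcases hW with rfl | h | h
    · exact absurd rfl hne
    · by_cases hl' : W = l.verts
      · exact ⟨_, (l.verts, r.verts), by simp [contractions], .inl hl'.symm, rfl⟩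
      · obtain ⟨X, p, hp, hpX⟩ := hl h hl'
        exact ⟨X, p, by simp [contractions, hp], hpX⟩
    · by_cases hr' : W = r.verts
      · exact ⟨_, (l.verts, r.verts), by simp [contractions], .inr hr'.symm, rfl⟩
      · obtain ⟨X, p, hp, hpX⟩ := hr h hr'
        exact ⟨X, p, by simp [contractions, hp], hpX⟩

theorem IsParent.mem_nodes {T : ContractionTree V} {X W : Finset V} (h : T.IsParent X W) :
    X ∈ T.nodes := by
  obtain ⟨p, hp, -, rfl⟩ := h
  exact union_mem_nodes hp

theorem IsParent.ssubset {T : ContractionTree V} (hT : T.leaves.Nodup) {X W : Finset V}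
    (h : T.IsParent X W) : W ⊂ X := by
  obtain ⟨p, hp, h, rfl⟩ := h
  have hd := disjoint_of_mem_contractions hT hp
  obtain ⟨x, hx⟩ := nonempty_of_mem_nodes (fst_mem_nodes hp)
  obtain ⟨y, hy⟩ := nonempty_of_mem_nodes (snd_mem_nodes hp)
  rcases h with rfl | rfl
  · refine ⟨Finset.subset_union_left, fun h => ?_⟩
    exact Finset.disjoint_left.1 hd (h (Finset.mem_union_right _ hy)) hy
  · refine ⟨Finset.subset_union_right, fun h => ?_⟩
    exact Finset.disjoint_left.1 hd hx (h (Finset.mem_union_left _ hx))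

theorem not_isParent_verts {T : ContractionTree V} (hT : T.leaves.Nodup) {X : Finset V} :
    ¬ T.IsParent X T.verts := fun h =>
  (h.ssubset hT).2 (subset_verts_of_mem_nodes h.mem_nodes)

theorem isParent_node {l r : ContractionTree V} {X W : Finset V} :
    (node l r).IsParent X W ↔
      ((l.verts = W ∨ r.verts = W) ∧ X = l.verts ∪ r.verts) ∨ l.IsParent X W ∨ r.IsParent X W := by
  simp only [IsParent, contractions, List.mem_cons, List.mem_append]
  constructor
  · rintro ⟨p, rfl | hp | hp, h⟩
    · exact .inl h
    · exact .inr (.inl ⟨p, hp, h⟩)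
    · exact .inr (.inr ⟨p, hp, h⟩)
  · rintro (h | ⟨p, hp, h⟩ | ⟨p, hp, h⟩)
    · exact ⟨_, .inl rfl, h⟩
    · exact ⟨p, .inr (.inl hp), h⟩
    · exact ⟨p, .inr (.inr hp), h⟩

theorem IsParent.child_mem_nodes {T : ContractionTree V} {X W : Finset V} (h : T.IsParent X W) :
    W ∈ T.nodes := by
  obtain ⟨p, hp, rfl | rfl, -⟩ := h
  · exact fst_mem_nodes hp
  · exact snd_mem_nodes hp

/-- A vertex lies in only one of the two subtrees, and the root of a subtree has no parent inside
that subtree. -/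
theorem IsParent.unique {T : ContractionTree V} (hT : T.leaves.Nodup) {X Y W : Finset V}
    (hX : T.IsParent X W) (hY : T.IsParent Y W) : X = Y := by
  induction T with
  | leaf u => obtain ⟨p, hp, -⟩ := hX; simp [contractions] at hp
  | node l r hl hr =>
    have hnl := (List.nodup_append.1 hT).1
    have hnr := (List.nodup_append.1 hT).2.1
    have key : ∀ {Z}, (l.verts = W ∨ r.verts = W) → ¬ (l.IsParent Z W ∨ r.IsParent Z W) := by
      rintro Z (rfl | rfl) (h | h)
      · exact not_isParent_verts hnl h
      · exact Finset.disjoint_left.1 (disjoint_nodes hT) l.verts_mem_nodes h.child_mem_nodes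
      · exact Finset.disjoint_left.1 (disjoint_nodes hT) h.child_mem_nodes r.verts_mem_nodes
      · exact not_isParent_verts hnr h
    rw [isParent_node] at hX hY
    rcases hX with ⟨h, rfl⟩ | hX <;> rcases hY with ⟨h', rfl⟩ | hY
    · rfl
    · exact (key h hY).elim
    · exact (key h' hX).elim
    · rcases hX with hX | hX <;> rcases hY with hY | hY
      · exact hl hnl hX hY
      · exact (Finset.disjoint_left.1 (disjoint_nodes hT) hX.child_mem_nodes
          hY.child_mem_nodes).elim
      · exact (Finset.disjoint_left.1 (disjoint_nodes hT) hY.child_mem_nodes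
          hX.child_mem_nodes).elim
      · exact hr hnr hX hY

/-- A union of two disjoint nonempty sets is not a singleton, so in `S` it arises from a
contraction, which is `p` by uniqueness in `T`. Thus a subtree containing a parent contains its
children. -/
theorem mem_contractions_of_union_mem_nodes {S T : ContractionTree V} (hT : T.leaves.Nodup)
    (hS : S.contractions ⊆ T.contractions) {p : Finset V × Finset V} (hp : p ∈ T.contractions)
    (h : p.1 ∪ p.2 ∈ S.nodes) : p ∈ S.contractions := by
  rcases mem_nodes_iff.1 h with ⟨v, -, hv⟩ | ⟨q, hq, hpq⟩
  · obtain ⟨x, hx⟩ := nonempty_of_mem_nodes (fst_mem_nodes hp)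
    obtain ⟨y, hy⟩ := nonempty_of_mem_nodes (snd_mem_nodes hp)
    have hx' := Finset.mem_singleton.1 (hv ▸ Finset.mem_union_left _ hx)
    have hy' := Finset.mem_singleton.1 (hv ▸ Finset.mem_union_right _ hy)
    exact (Finset.disjoint_left.1 (disjoint_of_mem_contractions hT hp) hx
      (by rwa [hx', ← hy'])).elim
  · rwa [contraction_eq_of_union_eq hT hp (hS hq) hpq]

theorem IsFull.verts_eq [Fintype V] {T : ContractionTree V} (hT : T.IsFull) :
    T.verts = Finset.univ :=
  Finset.eq_univ_of_forall fun v => mem_verts.2 (hT.mem_leaves v)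

theorem IsFull.length_leaves [Fintype V] {T : ContractionTree V} (hT : T.IsFull) :
    T.leaves.length = Fintype.card V := by
  rw [← List.toFinset_card_of_nodup hT.nodup, ← Finset.card_univ]
  congr 1
  exact Finset.eq_univ_of_forall fun v => List.mem_toFinset.2 (hT.mem_leaves v)

end

/-! ### The sketching contraction tree -/

section sketch
variable {V VE : Type*} [DecidableEq V]

theorem inl_mem_leaves_sketch {T : ContractionTree V} {z : (W : Finset V) → W ∈ T.nodes → VE}
    {v : V} : Sum.inl v ∈ (T.sketch z).leaves ↔ v ∈ T.leaves := by
  induction T with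
  | leaf u => simp [sketch, leaves]
  | node l r hl hr => simp [sketch, leaves, hl, hr]

theorem inr_mem_leaves_sketch {T : ContractionTree V} {z : (W : Finset V) → W ∈ T.nodes → VE}
    {x : VE} : Sum.inr x ∈ (T.sketch z).leaves ↔ ∃ W h, z W h = x := by
  induction T with
  | leaf u =>
    simp only [sketch, leaves, nodes]
    constructor
    · intro h
      exact ⟨{u}, by simp, by simpa [eq_comm] using h⟩
    · rintro ⟨W, h, rfl⟩
      obtain rfl := Finset.mem_singleton.1 h
      simp
  | node l r hl hr =>
    simp only [sketch, leaves, List.mem_append, List.mem_singleton, hl, hr]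
    constructor
    · rintro ((⟨W, h, rfl⟩ | ⟨W, h, rfl⟩) | h)
      · exact ⟨W, by simp [nodes, h], rfl⟩
      · exact ⟨W, by simp [nodes, h], rfl⟩
      · exact ⟨_, verts_mem_nodes _, (Sum.inr_injective h).symm⟩
    · rintro ⟨W, h, rfl⟩
      have h' := h
      simp only [nodes, Finset.mem_insert, Finset.mem_union] at h'
      rcases h' with rfl | h' | h'
      · exact .inr rfl
      · exact .inl (.inl ⟨W, h', rfl⟩)
      · exact .inl (.inr ⟨W, h', rfl⟩)

theorem nodup_leaves_sketch {T : ContractionTree V} {z : (W : Finset V) → W ∈ T.nodes → VE}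
    (hT : T.leaves.Nodup) (hz : ∀ W h W' h', z W h = z W' h' → W = W') :
    (T.sketch z).leaves.Nodup := by
  induction T with
  | leaf u => simp [sketch, leaves]
  | node l r hl hr =>
    have hnl := (List.nodup_append.1 hT).1
    have hnr := (List.nodup_append.1 hT).2.1
    simp only [sketch, leaves]
    rw [List.nodup_append, List.nodup_append]
    refine ⟨⟨hl hnl fun W h W' h' => hz _ _ _ _, hr hnr fun W h W' h' => hz _ _ _ _, ?_⟩,
      List.nodup_singleton _, ?_⟩
    · rintro (v | x) ha _ hb rfl
      · rw [inl_mem_leaves_sketch] at ha hb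
        exact (List.nodup_append.1 hT).2.2 v ha v hb rfl
      · rw [inr_mem_leaves_sketch] at ha hb
        obtain ⟨W, h, rfl⟩ := ha
        obtain ⟨W', h', he⟩ := hb
        obtain rfl := hz _ _ _ _ he
        exact Finset.disjoint_left.1 (disjoint_nodes hT) h h'
    · intro a ha b hb
      obtain rfl := List.mem_singleton.1 hb
      rintro rfl
      rcases List.mem_append.1 ha with ha | ha <;> obtain ⟨W, h, he⟩ := inr_mem_leaves_sketch.1 ha
      · obtain rfl := hz _ _ _ _ he
        exact union_verts_not_mem_left hT h
      · obtain rfl := hz _ _ _ _ he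
        exact union_verts_not_mem_right hT h

theorem toLeft_verts_sketch [DecidableEq VE] {T : ContractionTree V}
    {z : (W : Finset V) → W ∈ T.nodes → VE} : (T.sketch z).verts.toLeft = T.verts := by
  ext v
  rw [Finset.mem_toLeft, mem_verts, inl_mem_leaves_sketch, mem_verts]

theorem sketch_constrainedOn [DecidableEq VE] {T : ContractionTree V}
    {z : (W : Finset V) → W ∈ T.nodes → VE} : (T.sketch z).ConstrainedOn T := by
  induction T with
  | leaf u => intro p hp; simp [contractions] at hp
  | node l r hl hr =>
    intro p hp
    simp only [contractions, List.mem_cons, List.mem_append] at hp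
    rcases hp with rfl | hp | hp
    -- The match is the join of the two sketched subtrees, not the later contraction with the
    -- embedding tensor, which heads the list.
    · exact ⟨_, by simp only [sketch, contractions, List.mem_cons, List.mem_append]
                   exact .inr (.inl (.inl rfl)),
        .inl ⟨toLeft_verts_sketch, toLeft_verts_sketch⟩⟩
    · obtain ⟨q, hq, h⟩ := hl (z := fun W h => z W (by simp [nodes, h])) p hp
      exact ⟨q, by simp [sketch, contractions, hq], h⟩
    · obtain ⟨q, hq, h⟩ := hr (z := fun W h => z W (by simp [nodes, h])) p hp
      exact ⟨q, by simp [sketch, contractions, hq], h⟩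

end sketch
end ContractionTree

/-! ### Contraction costs as products of dimension sizes -/

namespace TensorNetwork
variable {V E : Type*} [Fintype V] [DecidableEq V] [Fintype E] [DecidableEq E]

theorem mem_edgesBetween {G : TensorNetwork V E} {A B : Finset V} {e : E} :
    e ∈ G.edgesBetween A B ↔ (∃ v ∈ A, v ∈ G.ends e) ∧ ∃ v ∈ B, v ∈ G.ends e := by
  simp only [edgesBetween, Finset.mem_filter, Finset.mem_univ, true_and, Finset.Nonempty,
    Finset.mem_inter, and_comm]

theorem mem_edgesOut {G : TensorNetwork V E} {A : Finset V} {e : E} :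
    e ∈ G.edgesOut A ↔ ((∃ v ∈ A, v ∈ G.ends e) ∧ ∃ v ∉ A, v ∈ G.ends e) ∨
      (e ∈ G.uncontracted ∧ G.ends e ⊆ A) := by
  rw [edgesOut, Finset.mem_union, mem_edgesBetween, edgesDangling, Finset.mem_filter]
  simp only [Finset.mem_compl]

/-- The delicate case is an uncontracted hyperedge inside `A ∪ B` but in neither set: it then runs
from `A` to outside `A`. -/
theorem edgesOut_union_subset (G : TensorNetwork V E) (A B : Finset V) : G.edgesOut (A ∪ B) ⊆ G.edgesOut A ∪ G.edgesOut B := by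
  intro e he
  rw [Finset.mem_union, mem_edgesOut, mem_edgesOut]
  rw [mem_edgesOut] at he
  rcases he with ⟨⟨v, hv, hve⟩, u, hu, hue⟩ | ⟨hd, hs⟩
  · rw [Finset.mem_union, not_or] at hu
    rcases Finset.mem_union.1 hv with hv | hv
    · exact .inl (.inl ⟨⟨v, hv, hve⟩, u, hu.1, hue⟩)
    · exact .inr (.inl ⟨⟨v, hv, hve⟩, u, hu.2, hue⟩)
  · by_cases hA : G.ends e ⊆ A
    · exact .inl (.inr ⟨hd, hA⟩)
    by_cases hB : G.ends e ⊆ B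
    · exact .inr (.inr ⟨hd, hB⟩)
    obtain ⟨u, hue, hu⟩ := Finset.not_subset.1 hA
    obtain ⟨v, hve, hv⟩ := Finset.not_subset.1 hB
    have hvA := (Finset.mem_union.1 (hs hve)).resolve_right hv
    exact .inl (.inl ⟨⟨v, hvA, hve⟩, u, hu, hue⟩)

/-- Every output dimension of a set has an end in it. Subtracting `cutBetween` is therefore
inclusion–exclusion for the two outputs. -/
theorem edgesBetween_eq_inter (G : TensorNetwork V E) (hG : ∀ e, (G.ends e).Nonempty)
    {A B : Finset V} (h : Disjoint A B) :
    G.edgesBetween A B = G.edgesOut A ∩ G.edgesOut B := by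
  have key : ∀ {e A}, e ∈ G.edgesOut A → ∃ v ∈ A, v ∈ G.ends e := by
    intro e A he
    rw [mem_edgesOut] at he
    rcases he with h | ⟨-, h⟩
    · exact h.1
    · obtain ⟨v, hv⟩ := hG e
      exact ⟨v, h hv, hv⟩
  ext e
  rw [Finset.mem_inter]
  constructor
  · rw [mem_edgesBetween, mem_edgesOut, mem_edgesOut]
    rintro ⟨⟨v, hv, hve⟩, u, hu, hue⟩
    exact ⟨.inl ⟨⟨v, hv, hve⟩, u, Finset.disjoint_right.1 h hu, hue⟩,
      .inl ⟨⟨u, hu, hue⟩, v, Finset.disjoint_left.1 h hv, hve⟩⟩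
  · rintro ⟨hA, hB⟩
    exact mem_edgesBetween.2 ⟨key hA, key hB⟩

/-- The cost of a contraction is the product of the sizes of all dimensions that occur in it. -/
theorem contractionCost_eq_prod (G : TensorNetwork V E) (hG : ∀ e, (G.ends e).Nonempty)
    (hs : ∀ e, 1 ≤ G.size e) {A B : Finset V} (h : Disjoint A B) :
    G.contractionCost A B = ∏ e ∈ G.edgesOut A ∪ G.edgesOut B, (G.size e : ℝ) := by
  have hsum : G.cut A + G.cut B - G.cutBetween A B =
      ∑ e ∈ G.edgesOut A ∪ G.edgesOut B, G.weight e := by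
    rw [cut, cut, cutBetween, edgesBetween_eq_inter G hG h, ← Finset.sum_union_inter,
      add_sub_cancel_right]
  rw [contractionCost, hsum, Real.exp_sum]
  exact Finset.prod_congr rfl fun e _ => Real.exp_log (by exact_mod_cast hs e)

theorem contractionCost_le (G : TensorNetwork V E) (hG : ∀ e, (G.ends e).Nonempty)
    (hs : ∀ e, 1 ≤ G.size e) {A B : Finset V} (h : Disjoint A B) {F : Finset E}
    (hF : G.edgesOut A ∪ G.edgesOut B ⊆ F) :
    G.contractionCost A B ≤ (∏ e ∈ F, G.size e : ℕ) := by
  rw [contractionCost_eq_prod G hG hs h, ← Nat.cast_prod, Nat.cast_le]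
  exact Finset.prod_le_prod_of_subset_of_one_le' hF fun e _ _ => hs e

theorem le_contractionCost (G : TensorNetwork V E) (hG : ∀ e, (G.ends e).Nonempty)
    (hs : ∀ e, 1 ≤ G.size e) {A B : Finset V} (h : Disjoint A B) {F : Finset E}
    (hF : F ⊆ G.edgesOut A ∪ G.edgesOut B) :
    (∏ e ∈ F, G.size e : ℕ) ≤ G.contractionCost A B := by
  rw [contractionCost_eq_prod G hG hs h, ← Nat.cast_prod, Nat.cast_le]
  exact Finset.prod_le_prod_of_subset_of_one_le' hF fun e _ _ => hs e

end TensorNetwork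

/-- A finite partial order can be listed in increasing order. -/
theorem exists_strictMono_equiv_fin (α : Type*) [Fintype α] [PartialOrder α] :
    ∃ f : α ≃ Fin (Fintype.card α), StrictMono f := by
  let _ : Fintype (LinearExtension α) := inferInstanceAs (Fintype α)
  have hc : Fintype.card (LinearExtension α) = Fintype.card α := rfl
  let g : α → LinearExtension α := toLinearExtension
  let o := (Fintype.orderIsoFinOfCardEq (LinearExtension α) hc).symm
  refine ⟨(Equiv.refl α : α ≃ LinearExtension α).trans o.toEquiv, fun a b h => ?_⟩
  refine o.strictMono (lt_of_le_of_ne (toLinearExtension.monotone h.le) h.ne)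

/-! ### The tree embedding is a tree and is admissible -/

namespace SketchingInput
open ContractionTree
variable {VD ED : Type*} [DecidableEq VD] [Fintype VD] {P : SketchingInput VD ED} {m : ℕ}

theorem mem_ends_treeEmbedding {X W : P.TreeNode} :
    X ∈ (P.treeEmbedding m).net.ends W ↔ X = W ∨ P.tree.IsParent X.1 W.1 := by
  simp [treeEmbedding]

theorem mem_uncontracted_treeEmbedding {W : P.TreeNode} :
    W ∈ (P.treeEmbedding m).net.uncontracted ↔ W.1 = P.tree.verts := by
  simp [treeEmbedding]

theorem uncontracted_treeEmbedding :
    (P.treeEmbedding m).net.uncontracted = {⟨P.tree.verts, P.tree.verts_mem_nodes⟩} := by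
  ext W
  rw [mem_uncontracted_treeEmbedding, Finset.mem_singleton, Subtype.ext_iff]

theorem ends_treeEmbedding_root {W : P.TreeNode} (hW : W.1 = P.tree.verts) :
    (P.treeEmbedding m).net.ends W = {W} := by
  ext X
  rw [mem_ends_treeEmbedding, Finset.mem_singleton, hW]
  exact or_iff_left (not_isParent_verts P.tree_full.nodup)

theorem ends_treeEmbedding_of_isParent {X W : P.TreeNode} (h : P.tree.IsParent X.1 W.1) :
    (P.treeEmbedding m).net.ends W = {W, X} := by
  ext Y
  rw [mem_ends_treeEmbedding, Finset.mem_insert, Finset.mem_singleton]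
  refine or_congr_right ⟨fun h' => Subtype.ext (h'.unique P.tree_full.nodup h), ?_⟩
  rintro rfl
  exact h

theorem exists_parent {W : P.TreeNode} (hW : W.1 ≠ P.tree.verts) :
    ∃ X : P.TreeNode, P.tree.IsParent X.1 W.1 := by
  obtain ⟨X, hX⟩ := exists_isParent W.2 hW
  exact ⟨⟨X, hX.mem_nodes⟩, hX⟩

theorem isParent_ne {X W : P.TreeNode} (h : P.tree.IsParent X.1 W.1) : W ≠ X := by
  rintro rfl
  exact (h.ssubset P.tree_full.nodup).2 subset_rfl

theorem isGraph_treeEmbedding (hm : 1 ≤ m) : (P.treeEmbedding m).net.IsGraph where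
  size_pos _ := hm
  card_uncontracted W hW := by
    rw [ends_treeEmbedding_root (mem_uncontracted_treeEmbedding.1 hW), Finset.card_singleton]
  card_contracted W hW := by
    obtain ⟨X, hX⟩ := exists_parent fun h => hW (mem_uncontracted_treeEmbedding.2 h)
    rw [ends_treeEmbedding_of_isParent hX, Finset.card_pair (isParent_ne hX)]

theorem sketchSize_treeEmbedding : (P.treeEmbedding m).sketchSize = m := by
  rw [Embedding.sketchSize, uncontracted_treeEmbedding, Finset.prod_singleton]
  rfl

theorem card_treeNode : Fintype.card P.TreeNode + 1 = 2 * Fintype.card VD := by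
  rw [← P.tree_full.length_leaves, ← card_nodes P.tree_full.nodup, Fintype.card_coe]

/-- The single edge named `W` suffices: it is the output, or it leads to the parent, which comes
later in any order extending inclusion. -/
theorem le_rowSize_treeEmbedding (hm : 1 ≤ m) {ord : P.TreeNode ≃ Fin (Fintype.card P.TreeNode)}
    (ho : StrictMono ord) (W : P.TreeNode) : m ≤ (P.treeEmbedding m).rowSize ord W := by
  have : W ∈ Finset.univ.filter fun f => W ∈ (P.treeEmbedding m).net.ends f ∧
      (f ∈ (P.treeEmbedding m).net.uncontracted ∨
        ∃ u ∈ (P.treeEmbedding m).net.ends f, ord W < ord u) := by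
    rw [Finset.mem_filter]
    refine ⟨Finset.mem_univ _, mem_ends_treeEmbedding.2 (.inl rfl), ?_⟩
    rw [mem_uncontracted_treeEmbedding]
    by_cases hW : W.1 = P.tree.verts
    · exact .inl hW
    · obtain ⟨X, hX⟩ := exists_parent hW
      refine .inr ⟨X, mem_ends_treeEmbedding.2 (.inr hX), ho ?_⟩
      exact hX.ssubset P.tree_full.nodup
  exact Finset.single_le_prod' (f := (P.treeEmbedding m).net.size) (fun _ _ => hm) this

theorem isAdmissible_treeEmbedding {c₀ c₁ c₂ ε δ : ℝ} (hm : 1 ≤ m) (hc₀₁ : c₀ ≤ c₁)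
    (hK : 0 ≤ Real.log (1 / δ) / ε ^ 2)
    (h₁ : c₁ * ((2 * Fintype.card VD - 1) * (Real.log (1 / δ) / ε ^ 2)) ≤ m)
    (h₂ : m ≤ c₂ * ((2 * Fintype.card VD - 1) * (Real.log (1 / δ) / ε ^ 2))) :
    (P.treeEmbedding m).IsAdmissible c₀ c₁ c₂ ε δ := by
  have hN : (Fintype.card P.TreeNode : ℝ) = 2 * Fintype.card VD - 1 := by
    rw [eq_sub_iff_add_eq]
    exact_mod_cast card_treeNode
  rw [← hN] at h₁ h₂
  refine ⟨isGraph_treeEmbedding hm, ?_, ?_, ?_, ?_⟩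
  · obtain ⟨ord, ho⟩ := exists_strictMono_equiv_fin P.TreeNode
    refine ⟨ord, fun W => ?_⟩
    refine (mul_le_mul_of_nonneg_right hc₀₁ (by positivity)).trans (h₁.trans ?_)
    exact_mod_cast le_rowSize_treeEmbedding hm ho W
  · rw [uncontracted_treeEmbedding, Finset.card_singleton]
  · rwa [sketchSize_treeEmbedding]
  · rwa [sketchSize_treeEmbedding]

theorem adj_treeEmbedding {X Y : P.TreeNode} :
    (P.treeEmbedding m).toSimpleGraph.Adj X Y ↔
      P.tree.IsParent X.1 Y.1 ∨ P.tree.IsParent Y.1 X.1 := by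
  have key : ∀ {X Y : P.TreeNode}, X ≠ Y → (∃ f, f ∉ (P.treeEmbedding m).net.uncontracted ∧
      X ∈ (P.treeEmbedding m).net.ends f ∧ Y ∈ (P.treeEmbedding m).net.ends f) →
      P.tree.IsParent X.1 Y.1 ∨ P.tree.IsParent Y.1 X.1 := by
    rintro X Y hne ⟨f, hf, hX, hY⟩
    rw [mem_ends_treeEmbedding] at hX hY
    rcases hX with rfl | hX <;> rcases hY with rfl | hY
    · exact (hne rfl).elim
    · exact .inr hY
    · exact .inl hX
    · exact (hne (Subtype.ext (hX.unique P.tree_full.nodup hY))).elim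
  have key' : ∀ {X Y : P.TreeNode}, P.tree.IsParent X.1 Y.1 →
      ∃ f, f ∉ (P.treeEmbedding m).net.uncontracted ∧
      X ∈ (P.treeEmbedding m).net.ends f ∧ Y ∈ (P.treeEmbedding m).net.ends f := by
    intro X Y h
    refine ⟨Y, fun hY => ?_, mem_ends_treeEmbedding.2 (.inr h), mem_ends_treeEmbedding.2 (.inl rfl)⟩
    rw [mem_uncontracted_treeEmbedding] at hY
    rw [hY] at h
    exact not_isParent_verts P.tree_full.nodup h
  rw [Embedding.toSimpleGraph, SimpleGraph.fromRel_adj]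
  constructor
  · rintro ⟨hne, h | h⟩
    · exact key hne h
    · exact (key hne.symm h).symm
  · rintro (h | h)
    · exact ⟨(isParent_ne h).symm, .inl (key' h)⟩
    · exact ⟨isParent_ne h, .inr (key' h)⟩

theorem reachable_root (W : P.TreeNode) : (P.treeEmbedding m).toSimpleGraph.Reachable W
    ⟨P.tree.verts, P.tree.verts_mem_nodes⟩ := by
  by_cases hW : W.1 = P.tree.verts
  · rw [show W = ⟨P.tree.verts, P.tree.verts_mem_nodes⟩ from Subtype.ext hW]
  · obtain ⟨X, hX⟩ := exists_parent hW
    have := Finset.card_lt_card (hX.ssubset P.tree_full.nodup)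
    have := Finset.card_le_univ X.1
    exact (adj_treeEmbedding.2 (.inr hX)).reachable.trans (reachable_root X)
termination_by Fintype.card VD - W.1.card

/-- Climbing to parents connects every vertex to the root, and each edge joins some non-root vertex
to its parent, so there are at most one fewer edges than vertices. -/
theorem isTree_treeEmbedding (hm : 1 ≤ m) : (P.treeEmbedding m).IsTree where
  graph := isGraph_treeEmbedding hm
  tree := by
    classical
    have hconn : (P.treeEmbedding m).toSimpleGraph.Connected :=
      { preconnected := fun X Y => (reachable_root X).trans (reachable_root Y).symm
        nonempty := ⟨⟨P.tree.verts, P.tree.verts_mem_nodes⟩⟩ }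
    rw [SimpleGraph.isTree_iff_connected_and_card]
    refine ⟨hconn, le_antisymm ?_ hconn.card_vert_le_card_edgeSet_add_one⟩
    choose! par hpar using fun (W : P.TreeNode) (hW : W.1 ≠ P.tree.verts) => exists_parent hW
    have hsub : (P.treeEmbedding m).toSimpleGraph.edgeFinset ⊆
        (Finset.univ.erase ⟨P.tree.verts, P.tree.verts_mem_nodes⟩).image
          fun W => s(W, par W) := by
      intro e
      induction e using Sym2.ind with
      | _ X Y =>
        rw [SimpleGraph.mem_edgeFinset, SimpleGraph.mem_edgeSet, adj_treeEmbedding,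
          Finset.mem_image]
        have key : ∀ {X Y : P.TreeNode}, P.tree.IsParent X.1 Y.1 →
            Y ∈ Finset.univ.erase ⟨P.tree.verts, P.tree.verts_mem_nodes⟩ ∧ par Y = X := by
          intro X Y h
          have hY : Y.1 ≠ P.tree.verts := fun hY => by
            rw [hY] at h
            exact not_isParent_verts P.tree_full.nodup h
          exact ⟨Finset.mem_erase.2 ⟨fun h => hY (congrArg Subtype.val h), Finset.mem_univ _⟩,
            Subtype.ext ((hpar Y hY).unique P.tree_full.nodup h)⟩
        rintro (h | h)
        · exact ⟨Y, (key h).1, by rw [(key h).2, Sym2.eq_swap]⟩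
        · exact ⟨X, (key h).1, by rw [(key h).2]⟩
    have hle := (Finset.card_le_card hsub).trans Finset.card_image_le
    rw [Finset.card_erase_of_mem (Finset.mem_univ _), Finset.card_univ] at hle
    have hpos : 0 < Fintype.card P.TreeNode :=
      Fintype.card_pos_iff.2 ⟨⟨P.tree.verts, P.tree.verts_mem_nodes⟩⟩
    rw [Nat.card_eq_fintype_card, Nat.card_eq_fintype_card, ← SimpleGraph.edgeFinset_card]
    omega
  no_parallel := by
    intro f g _ _ h
    -- Parallel edges with distinct names would make each name the parent of the other,
    -- contradicting strict inclusion.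
    have hf := mem_ends_treeEmbedding.1 (h ▸ mem_ends_treeEmbedding.2 (.inl rfl) :
      f ∈ (P.treeEmbedding m).net.ends g)
    have hg := mem_ends_treeEmbedding.1 (h ▸ mem_ends_treeEmbedding.2 (.inl rfl) :
      g ∈ (P.treeEmbedding m).net.ends f)
    rcases hf with hf | hf
    · exact hf
    rcases hg with hg | hg
    · exact hg.symm
    exact ((hf.ssubset P.tree_full.nodup).2 (hg.ssubset P.tree_full.nodup).1).elim

theorem isFull_treeSketch : P.treeSketch.IsFull where
  nodup := nodup_leaves_sketch P.tree_full.nodup fun _ _ _ _ h => congrArg Subtype.val h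
  mem_leaves := by
    rintro (v | ⟨W, hW⟩)
    · exact inl_mem_leaves_sketch.2 (P.tree_full.mem_leaves v)
    · exact inr_mem_leaves_sketch.2 ⟨W, hW, rfl⟩

end SketchingInput

/-! ### Dimensions of the overall network -/

namespace SketchingInput
open ContractionTree TensorNetwork

/-- The product of the sizes of all dimensions of a data tensor. -/
def tensorSize {VD ED : Type*} [DecidableEq VD] [Fintype ED] (P : SketchingInput VD ED)
    (v : VD) : ℕ :=
  ∏ e ∈ Finset.univ.filter fun e => v ∈ P.net.ends e, P.net.size e

/-- The product of the sizes of the dimensions not to be sketched that occur in the contraction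
of the outputs of `A` and `B`. -/
def unsketchedSize {VD ED : Type*} [Fintype VD] [DecidableEq VD] [Fintype ED] [DecidableEq ED]
    (P : SketchingInput VD ED) (A B : Finset VD) : ℕ :=
  ∏ e ∈ (P.net.edgesOut A ∪ P.net.edgesOut B) \ P.sketched, P.net.size e

section combined
variable {VD ED VE EE : Type*} [DecidableEq VD] [DecidableEq ED] [DecidableEq VE]
  {P : SketchingInput VD ED} {S : Embedding P.sketched VE EE}

theorem inl_mem_ends_inl {v : VD} {e : ED} :
    Sum.inl v ∈ (P.combined S).ends (Sum.inl e) ↔ v ∈ P.net.ends e := by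
  simp [combined]

theorem inr_mem_ends_inl {x : VE} {e : ED} :
    Sum.inr x ∈ (P.combined S).ends (Sum.inl e) ↔ ∃ h, S.attach ⟨e, h⟩ = x := by
  by_cases h : e ∈ P.sketched <;> simp [combined, h, eq_comm]

theorem inl_mem_ends_inr {v : VD} {f : EE} :
    Sum.inl v ∉ (P.combined S).ends (Sum.inr f) := by
  simp [combined]

theorem inr_mem_ends_inr {x : VE} {f : EE} :
    Sum.inr x ∈ (P.combined S).ends (Sum.inr f) ↔ x ∈ S.net.ends f := by
  simp [combined]

theorem inl_mem_uncontracted {e : ED} :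
    Sum.inl e ∈ (P.combined S).uncontracted ↔ e ∈ P.net.uncontracted ∧ e ∉ P.sketched := by
  simp [combined]

theorem inr_mem_uncontracted {f : EE} :
    Sum.inr f ∈ (P.combined S).uncontracted ↔ f ∈ S.net.uncontracted := by
  simp [combined]

theorem combined_size_pos (hS : S.net.IsGraph) (e : ED ⊕ EE) : 1 ≤ (P.combined S).size e := by
  rcases e with e | f
  · exact P.proper.size_pos e
  · exact hS.size_pos f

theorem combined_ends_nonempty (hS : S.net.IsGraph) (e : ED ⊕ EE) :
    ((P.combined S).ends e).Nonempty := by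
  rcases e with e | f
  · obtain ⟨v, hv⟩ := P.proper.ends_nonempty e
    exact ⟨_, inl_mem_ends_inl.2 hv⟩
  · have : (S.net.ends f).Nonempty := by
      rw [← Finset.card_pos]
      by_cases hf : f ∈ S.net.uncontracted
      · rw [hS.card_uncontracted f hf]; exact one_pos
      · rw [hS.card_contracted f hf]; exact two_pos
    obtain ⟨x, hx⟩ := this
    exact ⟨_, inr_mem_ends_inr.2 hx⟩

theorem eq_of_mem_ends_sketched {e : ED} (he : e ∈ P.sketched) {u v : VD}
    (hu : u ∈ P.net.ends e) (hv : v ∈ P.net.ends e) : u = v :=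
  Finset.card_le_one.1 (P.card_ends_of_sketched e he).le u hu v hv

theorem prod_disjSum_combined {A : Finset ED} {B : Finset EE} :
    ∏ e ∈ A.disjSum B, (P.combined S).size e =
      (∏ e ∈ A, P.net.size e) * ∏ f ∈ B, S.net.size f := by
  rw [Finset.prod_disjSum]
  rfl

variable [Fintype VD] [Fintype ED] [Fintype VE] [Fintype EE] [DecidableEq EE]

/-- An unsketched hyperedge keeps its data ends and its dangling status and gains no embedding end,
so only the data part of `X` matters. -/
theorem inl_mem_edgesOut_of_not_sketched {e : ED} (he : e ∉ P.sketched)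
    {X : Finset (VD ⊕ VE)} :
    Sum.inl e ∈ (P.combined S).edgesOut X ↔ e ∈ P.net.edgesOut X.toLeft := by
  have hr : ∀ x, Sum.inr x ∉ (P.combined S).ends (Sum.inl e) := fun x hx =>
    he (inr_mem_ends_inl.1 hx).1
  simp only [mem_edgesOut, Sum.exists, inl_mem_ends_inl, hr, and_false, exists_false, or_false,
    Finset.mem_toLeft, inl_mem_uncontracted, he, not_false_eq_true, and_true, Finset.subset_iff,
    Sum.forall, false_imp_iff, implies_true]

theorem exists_mem_of_mem_edgesOut (hS : S.net.IsGraph) {X : Finset (VD ⊕ VE)} {e : ED ⊕ EE}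
    (he : e ∈ (P.combined S).edgesOut X) : ∃ v ∈ X, v ∈ (P.combined S).ends e := by
  rw [mem_edgesOut] at he
  rcases he with h | ⟨-, h⟩
  · exact h.1
  · obtain ⟨v, hv⟩ := combined_ends_nonempty hS e
    exact ⟨v, h hv, hv⟩

/-- If `v` is the only end in the overall network, the hyperedge is neither sketched nor contracted,
so it dangles. -/
theorem inl_mem_edgesOut_singleton {v : VD} {e : ED} (hv : v ∈ P.net.ends e) :
    Sum.inl e ∈ (P.combined S).edgesOut {Sum.inl v} := by
  rw [mem_edgesOut]
  by_cases h : ∃ u ∉ ({Sum.inl v} : Finset (VD ⊕ VE)), u ∈ (P.combined S).ends (Sum.inl e)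
  · exact .inl ⟨⟨_, Finset.mem_singleton_self _, inl_mem_ends_inl.2 hv⟩, h⟩
  · push Not at h
    refine .inr ⟨?_, fun u hu => by_contra fun hu' => h u hu' hu⟩
    have hs : e ∉ P.sketched := fun hs =>
      h (Sum.inr (S.attach ⟨e, hs⟩)) (by simp) (inr_mem_ends_inl.2 ⟨hs, rfl⟩)
    refine inl_mem_uncontracted.2 ⟨by_contra fun hc => ?_, hs⟩
    obtain ⟨u, hu, hne⟩ := Finset.exists_mem_ne (P.proper.two_le_of_contracted e hc) v
    exact h (Sum.inl u) (by simpa using hne) (inl_mem_ends_inl.2 hu)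

end combined

/-! ### Upper bound for the sketching tree -/

section upper
variable {VD ED : Type*} [Fintype VD] [DecidableEq VD] [Fintype ED] [DecidableEq ED]
  {P : SketchingInput VD ED} {m : ℕ} {T : ContractionTree VD}

theorem inl_mem_verts_sketch (hn : ∀ W ∈ T.nodes, W ∈ P.tree.nodes) {v : VD} :
    Sum.inl v ∈ (T.sketch fun W h => (⟨W, hn W h⟩ : P.TreeNode)).verts ↔ v ∈ T.verts := by
  rw [mem_verts, inl_mem_leaves_sketch, mem_verts]

theorem inr_mem_verts_sketch (hn : ∀ W ∈ T.nodes, W ∈ P.tree.nodes) {X : P.TreeNode} :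
    Sum.inr X ∈ (T.sketch fun W h => (⟨W, hn W h⟩ : P.TreeNode)).verts ↔ X.1 ∈ T.nodes := by
  rw [mem_verts, inr_mem_leaves_sketch]
  exact ⟨fun ⟨W, h, he⟩ => he ▸ h, fun h => ⟨_, h, rfl⟩⟩

theorem attach_treeEmbedding {e : ED} {he : e ∈ P.sketched} {v : VD} (hv : v ∈ P.net.ends e) :
    ((P.treeEmbedding m).attach ⟨e, he⟩).1 = {v} :=
  Finset.eq_singleton_iff_unique_mem.2 ⟨hv, fun _ hu => eq_of_mem_ends_sketched he hu hv⟩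

/-- In a sketched subtree, all sketched edges have been contracted. -/
theorem not_mem_edgesOut_sketch (hn : ∀ W ∈ T.nodes, W ∈ P.tree.nodes) {e : ED}
    (he : e ∈ P.sketched) : Sum.inl e ∉ (P.combined (P.treeEmbedding m)).edgesOut
      (T.sketch fun W h => (⟨W, hn W h⟩ : P.TreeNode)).verts := by
  obtain ⟨v, hv⟩ := P.proper.ends_nonempty e
  -- Both ends of a sketched edge, the data tensor and its embedding matrix, enter the sketched
  -- subtree together.
  have hmem : ∀ u, u ∈ (P.combined (P.treeEmbedding m)).ends (Sum.inl e) →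
      (u ∈ (T.sketch fun W h => (⟨W, hn W h⟩ : P.TreeNode)).verts ↔ v ∈ T.verts) := by
    rintro (u | X) hu
    · rw [eq_of_mem_ends_sketched he (inl_mem_ends_inl.1 hu) hv, inl_mem_verts_sketch]
    · obtain ⟨_, rfl⟩ := inr_mem_ends_inl.1 hu
      rw [inr_mem_verts_sketch, attach_treeEmbedding hv]
      exact ⟨fun h => subset_verts_of_mem_nodes h (Finset.mem_singleton_self v),
        fun h => singleton_mem_nodes (mem_verts.1 h)⟩
  rw [mem_edgesOut]
  rintro (⟨⟨a, ha, hae⟩, b, hb, hbe⟩ | ⟨h, -⟩)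
  · exact hb ((hmem b hbe).2 ((hmem a hae).1 ha))
  · exact (inl_mem_uncontracted.1 h).2 he

/-- The only embedding dimension left in a sketched subtree is the one of its root. -/
theorem eq_verts_of_mem_edgesOut_sketch (hn : ∀ W ∈ T.nodes, W ∈ P.tree.nodes)
    (hc : T.contractions ⊆ P.tree.contractions) {W : P.TreeNode}
    (hW : Sum.inr W ∈ (P.combined (P.treeEmbedding m)).edgesOut
      (T.sketch fun W h => (⟨W, hn W h⟩ : P.TreeNode)).verts) : W.1 = T.verts := by
  have hchild : ∀ {X : P.TreeNode}, P.tree.IsParent X.1 W.1 → X.1 ∈ T.nodes → W.1 ∈ T.nodes := by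
    rintro X ⟨p, hp, h, hX⟩ hXT
    have := mem_contractions_of_union_mem_nodes P.tree_full.nodup hc hp (hX ▸ hXT)
    rcases h with h | h
    · exact h ▸ fst_mem_nodes this
    · exact h ▸ snd_mem_nodes this
  rw [mem_edgesOut] at hW
  rcases hW with ⟨⟨a, ha, hae⟩, b, hb, hbe⟩ | ⟨hd, hs⟩
  · rcases a with v | X
    · exact (inl_mem_ends_inr hae).elim
    rcases b with v | Y
    · exact (inl_mem_ends_inr hbe).elim
    rw [inr_mem_ends_inr, mem_ends_treeEmbedding] at hae hbe
    rw [inr_mem_verts_sketch] at ha hb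
    have hWT : W.1 ∈ T.nodes := by
      rcases hae with rfl | h
      · exact ha
      · exact hchild h ha
    -- Below the root of `T`, the parent of `W` is also in `T`, so the edge would have both ends
    -- inside.
    by_contra hne
    rcases hbe with rfl | h
    · exact hb hWT
    · obtain ⟨Z, p, hp, hZ⟩ := exists_isParent hWT hne
      have hZ' : P.tree.IsParent Z W.1 := ⟨p, hc hp, hZ⟩
      exact hb (h.unique P.tree_full.nodup hZ' ▸ IsParent.mem_nodes ⟨p, hp, hZ⟩)
  · have hWT := (inr_mem_verts_sketch hn).1
      (hs (inr_mem_ends_inr.2 (mem_ends_treeEmbedding.2 (.inl rfl))))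
    refine (subset_verts_of_mem_nodes hWT).antisymm ?_
    rw [mem_uncontracted_treeEmbedding.1 (inr_mem_uncontracted.1 hd)]
    exact subset_verts_of_mem_nodes (hn _ T.verts_mem_nodes)

/-- A singleton vertex has no children, so besides dimensions of `v` the embedding matrix has only
its edge to the parent (or output), of size `m`. -/
theorem leaf_cost_le (hm : 1 ≤ m) {v : VD} {X : P.TreeNode} (hX : X.1 = {v}) :
    (P.combined (P.treeEmbedding m)).contractionCost {Sum.inl v} {Sum.inr X} ≤
      m * P.tensorSize v := by
  have hG : (P.treeEmbedding m).net.IsGraph := isGraph_treeEmbedding hm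
  have hsub : (P.combined (P.treeEmbedding m)).edgesOut {Sum.inl v} ∪
      (P.combined (P.treeEmbedding m)).edgesOut {Sum.inr X} ⊆
      (Finset.univ.filter fun e => v ∈ P.net.ends e).disjSum {X} := by
    intro e he
    rcases Finset.mem_union.1 he with he | he <;>
      obtain ⟨u, hu, hue⟩ := exists_mem_of_mem_edgesOut hG he <;>
      obtain rfl := Finset.mem_singleton.1 hu
    · rcases e with e | W
      · rw [Finset.inl_mem_disjSum, Finset.mem_filter]
        exact ⟨Finset.mem_univ _, inl_mem_ends_inl.1 hue⟩
      · exact (inl_mem_ends_inr hue).elim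
    · rcases e with e | W
      · rw [Finset.inl_mem_disjSum, Finset.mem_filter]
        obtain ⟨h, rfl⟩ := inr_mem_ends_inl.1 hue
        refine ⟨Finset.mem_univ _, ?_⟩
        change P.net.ends e = {v} at hX
        rw [hX]
        exact Finset.mem_singleton_self v
      · rw [Finset.inr_mem_disjSum, Finset.mem_singleton]
        rcases mem_ends_treeEmbedding.1 (inr_mem_ends_inr.1 hue) with h | h
        · exact h.symm
        · have := h.ssubset P.tree_full.nodup
          rw [hX, Finset.ssubset_singleton_iff] at this
          exact ((nonempty_of_mem_nodes W.2).ne_empty this).elim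
  refine (contractionCost_le _ (combined_ends_nonempty hG) (combined_size_pos hG) (by simp)
    hsub).trans_eq ?_
  rw [prod_disjSum_combined, Finset.prod_singleton, mul_comm, Nat.cast_mul]
  rfl

theorem not_sketched_of_mem_edgesBetween {A B : Finset VD} (h : Disjoint A B) {e : ED}
    (he : e ∈ P.net.edgesBetween A B) : e ∉ P.sketched := fun hs => by
  obtain ⟨⟨u, hu, hue⟩, v, hv, hve⟩ := mem_edgesBetween.1 he
  obtain rfl := eq_of_mem_ends_sketched hs hue hve
  exact Finset.disjoint_left.1 h hu hv

/-- Surviving and contracted dimensions are disjoint parts of those in the contraction. A contracted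
one is unsketched, as it has ends in both `A` and `B`. -/
theorem prod_edgesOut_union_mul_contractedSize_le {A B : Finset VD} (h : Disjoint A B) :
    (∏ e ∈ P.net.edgesOut (A ∪ B) \ P.sketched, P.net.size e) * P.net.contractedSize A B ≤
      P.unsketchedSize A B := by
  rw [contractedSize, ← Finset.prod_union, unsketchedSize]
  · refine Finset.prod_le_prod_of_subset_of_one_le' (Finset.union_subset ?_ ?_)
      fun e _ _ => P.proper.size_pos e
    · exact Finset.sdiff_subset_sdiff (edgesOut_union_subset _ _ _) subset_rfl
    · intro e he
      have he := (Finset.mem_sdiff.1 he).1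
      refine Finset.mem_sdiff.2 ⟨?_, not_sketched_of_mem_edgesBetween h he⟩
      rw [edgesBetween_eq_inter _ P.proper.ends_nonempty h] at he
      exact Finset.mem_union_left _ (Finset.mem_inter.1 he).1
  · exact Finset.disjoint_left.2 fun e he he' =>
      (Finset.mem_sdiff.1 he').2 (Finset.mem_sdiff.1 he).1

variable {l r : ContractionTree VD}

/-- Each operand contributes one embedding edge, hence the factor `m ^ 2`. -/
theorem join_cost_le (hm : 1 ≤ m) (hnl : ∀ W ∈ l.nodes, W ∈ P.tree.nodes)
    (hnr : ∀ W ∈ r.nodes, W ∈ P.tree.nodes) (hcl : l.contractions ⊆ P.tree.contractions)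
    (hcr : r.contractions ⊆ P.tree.contractions)
    (hd : Disjoint (l.sketch fun W h => (⟨W, hnl W h⟩ : P.TreeNode)).verts
      (r.sketch fun W h => (⟨W, hnr W h⟩ : P.TreeNode)).verts) :
    (P.combined (P.treeEmbedding m)).contractionCost
      (l.sketch fun W h => (⟨W, hnl W h⟩ : P.TreeNode)).verts
      (r.sketch fun W h => (⟨W, hnr W h⟩ : P.TreeNode)).verts ≤
      m ^ 2 * P.unsketchedSize l.verts r.verts := by
  have hG : (P.treeEmbedding m).net.IsGraph := isGraph_treeEmbedding hm
  refine (contractionCost_le _ (combined_ends_nonempty hG) (combined_size_pos hG) hd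
    (F := ((P.net.edgesOut l.verts ∪ P.net.edgesOut r.verts) \ P.sketched).disjSum
      {⟨l.verts, hnl _ l.verts_mem_nodes⟩, ⟨r.verts, hnr _ r.verts_mem_nodes⟩}) ?_).trans ?_
  · rintro (e | W) he
    · have hs : e ∉ P.sketched := fun hs => (Finset.mem_union.1 he).elim
        (not_mem_edgesOut_sketch hnl hs) (not_mem_edgesOut_sketch hnr hs)
      rw [Finset.mem_union, inl_mem_edgesOut_of_not_sketched hs, toLeft_verts_sketch,
        inl_mem_edgesOut_of_not_sketched hs, toLeft_verts_sketch] at he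
      rw [Finset.inl_mem_disjSum, Finset.mem_sdiff, Finset.mem_union]
      exact ⟨he, hs⟩
    · rw [Finset.inr_mem_disjSum, Finset.mem_insert, Finset.mem_singleton]
      exact (Finset.mem_union.1 he).imp
        (fun h => Subtype.ext (eq_verts_of_mem_edgesOut_sketch hnl hcl h))
        (fun h => Subtype.ext (eq_verts_of_mem_edgesOut_sketch hnr hcr h))
  · rw [prod_disjSum_combined, mul_comm]
    have : ∏ f ∈ ({⟨l.verts, hnl _ l.verts_mem_nodes⟩, ⟨r.verts, hnr _ r.verts_mem_nodes⟩} :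
        Finset P.TreeNode), (P.treeEmbedding m).net.size f ≤ m ^ 2 := by
      exact (Finset.prod_const m).trans_le <| Nat.pow_le_pow_right hm Finset.card_le_two
    exact_mod_cast Nat.mul_le_mul_right _ this

/-- The embedding tensor meets its own edge and those of its two children, giving `m ^ 3`. One
factor `m` is absorbed by `hmp`, since the contracted data dimensions are already gone. -/
theorem compress_cost_le (hm : 1 ≤ m) (hnl : ∀ W ∈ l.nodes, W ∈ P.tree.nodes)
    (hnr : ∀ W ∈ r.nodes, W ∈ P.tree.nodes) (hcl : l.contractions ⊆ P.tree.contractions)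
    (hcr : r.contractions ⊆ P.tree.contractions)
    (hp : (l.verts, r.verts) ∈ P.tree.contractions) {X : P.TreeNode}
    (hX : X.1 = l.verts ∪ r.verts)
    (hmp : m ≤ P.net.contractedSize l.verts r.verts)
    (hd : Disjoint ((l.sketch fun W h => (⟨W, hnl W h⟩ : P.TreeNode)).verts ∪
      (r.sketch fun W h => (⟨W, hnr W h⟩ : P.TreeNode)).verts) {Sum.inr X}) :
    (P.combined (P.treeEmbedding m)).contractionCost
      ((l.sketch fun W h => (⟨W, hnl W h⟩ : P.TreeNode)).verts ∪
      (r.sketch fun W h => (⟨W, hnr W h⟩ : P.TreeNode)).verts) {Sum.inr X} ≤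
      m ^ 2 * P.unsketchedSize l.verts r.verts := by
  have hG : (P.treeEmbedding m).net.IsGraph := isGraph_treeEmbedding hm
  have hlr := disjoint_of_mem_contractions P.tree_full.nodup hp
  have hsk : ∀ e ∈ P.sketched, Sum.inr X ∉ (P.combined (P.treeEmbedding m)).ends (Sum.inl e) := by
    intro e he h
    obtain ⟨_, rfl⟩ := inr_mem_ends_inl.1 h
    obtain ⟨x, hx⟩ := l.verts_nonempty
    obtain ⟨y, hy⟩ := r.verts_nonempty
    change P.net.ends e = _ at hX
    obtain rfl := eq_of_mem_ends_sketched he (hX ▸ Finset.mem_union_left _ hx)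
      (hX ▸ Finset.mem_union_right _ hy)
    exact Finset.disjoint_left.1 hlr hx hy
  refine (contractionCost_le _ (combined_ends_nonempty hG) (combined_size_pos hG) hd
    (F := (P.net.edgesOut (l.verts ∪ r.verts) \ P.sketched).disjSum
      {⟨l.verts, hnl _ l.verts_mem_nodes⟩, ⟨r.verts, hnr _ r.verts_mem_nodes⟩, X}) ?_).trans ?_
  · rintro (e | W) he
    · have hs : e ∉ P.sketched := fun hs => by
        rcases Finset.mem_union.1 he with he | he
        · exact (Finset.mem_union.1 (edgesOut_union_subset _ _ _ he)).elim
            (not_mem_edgesOut_sketch hnl hs) (not_mem_edgesOut_sketch hnr hs)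
        · obtain ⟨u, hu, hue⟩ := exists_mem_of_mem_edgesOut hG he
          obtain rfl := Finset.mem_singleton.1 hu
          exact hsk e hs hue
      rw [Finset.inl_mem_disjSum, Finset.mem_sdiff]
      refine ⟨?_, hs⟩
      rcases Finset.mem_union.1 he with he | he
      · rwa [inl_mem_edgesOut_of_not_sketched hs, Finset.toLeft_union, toLeft_verts_sketch,
          toLeft_verts_sketch] at he
      · obtain ⟨u, hu, hue⟩ := exists_mem_of_mem_edgesOut hG he
        obtain rfl := Finset.mem_singleton.1 hu
        exact (hs (inr_mem_ends_inl.1 hue).1).elim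
    · simp only [Finset.inr_mem_disjSum, Finset.mem_insert, Finset.mem_singleton]
      rcases Finset.mem_union.1 he with he | he
      · rcases Finset.mem_union.1 (edgesOut_union_subset _ _ _ he) with h | h
        · exact .inl (Subtype.ext (eq_verts_of_mem_edgesOut_sketch hnl hcl h))
        · exact .inr (.inl (Subtype.ext (eq_verts_of_mem_edgesOut_sketch hnr hcr h)))
      · obtain ⟨u, hu, hue⟩ := exists_mem_of_mem_edgesOut hG he
        obtain rfl := Finset.mem_singleton.1 hu
        rcases mem_ends_treeEmbedding.1 (inr_mem_ends_inr.1 hue) with h | ⟨q, hq, h, hq'⟩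
        · exact .inr (.inr h.symm)
        · obtain rfl := contraction_eq_of_union_eq P.tree_full.nodup hq hp (hq'.symm.trans hX)
          exact h.elim (fun h => .inl (Subtype.ext h.symm))
            (fun h => .inr (.inl (Subtype.ext h.symm)))
  · rw [prod_disjSum_combined]
    have h3 : ∏ f ∈ ({⟨l.verts, hnl _ l.verts_mem_nodes⟩, ⟨r.verts, hnr _ r.verts_mem_nodes⟩, X} :
        Finset P.TreeNode), (P.treeEmbedding m).net.size f ≤ m ^ 3 := by
      exact (Finset.prod_const m).trans_le <| Nat.pow_le_pow_right hm Finset.card_le_three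
    have hu := prod_edgesOut_union_mul_contractedSize_le (P := P) hlr
    have : (∏ e ∈ P.net.edgesOut (l.verts ∪ r.verts) \ P.sketched, P.net.size e) *
        ∏ f ∈ ({⟨l.verts, hnl _ l.verts_mem_nodes⟩, ⟨r.verts, hnr _ r.verts_mem_nodes⟩, X} :
        Finset P.TreeNode), (P.treeEmbedding m).net.size f ≤
        m ^ 2 * P.unsketchedSize l.verts r.verts := calc
      _ ≤ (∏ e ∈ P.net.edgesOut (l.verts ∪ r.verts) \ P.sketched, P.net.size e) * m ^ 3 :=
        Nat.mul_le_mul_left _ h3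
      _ = m ^ 2 * ((∏ e ∈ P.net.edgesOut (l.verts ∪ r.verts) \ P.sketched, P.net.size e) * m) := by
        ring
      _ ≤ _ := Nat.mul_le_mul_left _ ((Nat.mul_le_mul_left _ hmp).trans hu)
    exact_mod_cast this

/-- The factor 2 accounts for the join and the compression that replace each contraction. -/
theorem sketch_cost_le (hm : 1 ≤ m)
    (hmp : ∀ p ∈ P.tree.contractions, m ≤ P.net.contractedSize p.1 p.2)
    (hT : T.leaves.Nodup) (hn : ∀ W ∈ T.nodes, W ∈ P.tree.nodes)
    (hc : T.contractions ⊆ P.tree.contractions) :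
    (T.sketch fun W h => (⟨W, hn W h⟩ : P.TreeNode)).cost (P.combined (P.treeEmbedding m)) ≤
      (T.leaves.map fun v => (m * P.tensorSize v : ℝ)).sum +
      (T.contractions.map fun p => 2 * (m ^ 2 * P.unsketchedSize p.1 p.2 : ℝ)).sum := by
  induction T with
  | leaf v =>
    simpa [sketch, cost, contractions, leaves, verts] using leaf_cost_le hm rfl
  | node l r hl hr =>
    have hnd := nodup_leaves_sketch (z := fun W h => (⟨W, hn W h⟩ : P.TreeNode)) hT
      fun _ _ _ _ h => congrArg Subtype.val h
    simp only [sketch] at hnd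
    have hd := disjoint_verts hnd
    simp only [verts] at hd
    rw [leaves] at hnd
    have hd' := disjoint_verts (List.nodup_append.1 hnd).1
    have hnl : ∀ W ∈ l.nodes, W ∈ P.tree.nodes := fun W h => hn W (by simp [nodes, h])
    have hnr : ∀ W ∈ r.nodes, W ∈ P.tree.nodes := fun W h => hn W (by simp [nodes, h])
    have hcl : l.contractions ⊆ P.tree.contractions := fun p h => hc (by simp [contractions, h])
    have hcr : r.contractions ⊆ P.tree.contractions := fun p h => hc (by simp [contractions, h])
    have hp : (l.verts, r.verts) ∈ P.tree.contractions := hc (by simp [contractions])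
    have h₁ := hl (List.nodup_append.1 hT).1 hnl hcl
    have h₂ := hr (List.nodup_append.1 hT).2.1 hnr hcr
    have h₃ := join_cost_le hm hnl hnr hcl hcr hd'
    have h₄ := compress_cost_le hm hnl hnr hcl hcr hp
      (X := ⟨l.verts ∪ r.verts, hn _ (verts_mem_nodes (node l r))⟩) rfl (hmp (_, _) hp) hd
    simp only [cost] at h₁ h₂
    simp only [sketch, cost, contractions, leaves, List.map_cons, List.map_append, List.sum_cons,
      List.sum_append, List.map_nil, List.sum_nil, verts]
    linarith

end upper
end SketchingInput

/-! ### Row dimensions of an arbitrary graph embedding -/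

theorem Finset.exists_last {α : Type*} {n : ℕ} (ord : α ≃ Fin n) {s : Finset α}
    (hs : s.Nonempty) : ∃ x ∈ s, ∀ y ∈ s, ¬ ord x < ord y := by
  obtain ⟨x, hx, h⟩ := s.exists_max_image ord hs
  exact ⟨x, hx, fun y hy => not_lt.2 (h y hy)⟩

namespace Embedding
variable {ED : Type*} {sketched : Finset ED} {VE EE : Type*}
  [Fintype VE] [DecidableEq VE] [Fintype EE] [DecidableEq EE]

/-- The dimensions whose sizes are multiplied in `rowSize`. -/
def rowDims (S : Embedding sketched VE EE) (ord : VE ≃ Fin (Fintype.card VE)) (v : VE) :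
    Finset EE :=
  Finset.univ.filter fun f => v ∈ S.net.ends f ∧
    (f ∈ S.net.uncontracted ∨ ∃ u ∈ S.net.ends f, ord v < ord u)

variable {S : Embedding sketched VE EE} {ord : VE ≃ Fin (Fintype.card VE)}

theorem mem_rowDims {v : VE} {f : EE} : f ∈ S.rowDims ord v ↔ v ∈ S.net.ends f ∧
    (f ∈ S.net.uncontracted ∨ ∃ u ∈ S.net.ends f, ord v < ord u) := by
  simp [rowDims]

/-- An output edge has one end, and a contracted edge is a row dimension only of the earlier of its
two ends. -/
theorem disjoint_rowDims (hS : S.net.IsGraph) {x y : VE} (hne : x ≠ y) :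
    Disjoint (S.rowDims ord x) (S.rowDims ord y) := by
  wlog h : ord x < ord y generalizing x y
  · exact (this hne.symm (lt_of_le_of_ne (not_lt.1 h) (ord.injective.ne hne.symm))).symm
  rw [Finset.disjoint_left]
  intro f hx hy
  rw [mem_rowDims] at hx hy
  have hf : f ∉ S.net.uncontracted := fun hf =>
    hne (Finset.card_le_one.1 (hS.card_uncontracted f hf).le x hx.1 y hy.1)
  obtain ⟨u, hu, hlt⟩ := hy.2.resolve_left hf
  have hends : ({x, y} : Finset VE) = S.net.ends f := by
    refine Finset.eq_of_subset_of_card_le ?_ ?_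
    · intro z hz
      rcases Finset.mem_insert.1 hz with rfl | hz
      · exact hx.1
      · rw [Finset.mem_singleton.1 hz]; exact hy.1
    · rw [hS.card_contracted f hf, Finset.card_pair hne]
  rw [← hends, Finset.mem_insert, Finset.mem_singleton] at hu
  rcases hu with rfl | rfl
  · exact lt_asymm h hlt
  · exact lt_irrefl _ hlt

end Embedding

/-! ### Lower bound for every constrained contraction tree -/

namespace SketchingInput
open ContractionTree TensorNetwork
variable {VD ED : Type*} [Fintype VD] [DecidableEq VD] [Fintype ED] [DecidableEq ED]
  {P : SketchingInput VD ED} {VE EE : Type*}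
  [Fintype VE] [DecidableEq VE] [Fintype EE] [DecidableEq EE] {S : Embedding P.sketched VE EE}
  {ord : VE ≃ Fin (Fintype.card VE)} {b : ℝ}

/-- Later neighbours of the last embedding tensor of `X` lie outside `X`. -/
theorem rowDims_subset_edgesOut (hS : S.net.IsGraph) {X : Finset (VD ⊕ VE)} {x : VE}
    (hx : x ∈ X.toRight) (hlast : ∀ y ∈ X.toRight, ¬ ord x < ord y) {f : EE}
    (hf : f ∈ S.rowDims ord x) : Sum.inr f ∈ (P.combined S).edgesOut X := by
  rw [Embedding.mem_rowDims] at hf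
  rw [Finset.mem_toRight] at hx
  rw [mem_edgesOut]
  rcases hf with ⟨hxf, hf | ⟨u, hu, hlt⟩⟩
  · refine .inr ⟨inr_mem_uncontracted.2 hf, ?_⟩
    rintro (v | y) hy
    · exact (inl_mem_ends_inr hy).elim
    · rwa [Finset.card_le_one.1 (hS.card_uncontracted f hf).le y (inr_mem_ends_inr.1 hy) x hxf]
  · exact .inl ⟨⟨_, hx, inr_mem_ends_inr.2 hxf⟩, Sum.inr u,
      fun h => hlast u (Finset.mem_toRight.2 h) hlt, inr_mem_ends_inr.2 hu⟩

/-- A set of embedding and sketched dimensions of the output of `X`: one edge to be sketched, or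
the row dimensions of a tensor in `X`. -/
def IsExternal (S : Embedding P.sketched VE EE) (ord : VE ≃ Fin (Fintype.card VE))
    (X : Finset (VD ⊕ VE)) (F : Finset (ED ⊕ EE)) : Prop :=
  (∃ e ∈ P.sketched, ∃ v, Sum.inl v ∈ X ∧ v ∈ P.net.ends e ∧ F = {Sum.inl e}) ∨
    ∃ x, Sum.inr x ∈ X ∧ F = (S.rowDims ord x).map .inr

theorem IsExternal.disjoint (hS : S.net.IsGraph) {X Y : Finset (VD ⊕ VE)} (hXY : Disjoint X Y)
    {F F' : Finset (ED ⊕ EE)} (hF : IsExternal S ord X F) (hF' : IsExternal S ord Y F') :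
    Disjoint F F' := by
  rcases hF with ⟨e, he, v, hvX, hve, rfl⟩ | ⟨x, hx, rfl⟩ <;>
    rcases hF' with ⟨e', he', v', hvY, hve', rfl⟩ | ⟨y, hy, rfl⟩
  · rw [Finset.disjoint_singleton, Ne, Sum.inl.injEq]
    rintro rfl
    rw [eq_of_mem_ends_sketched he hve hve'] at hvX
    exact Finset.disjoint_left.1 hXY hvX hvY
  · simp
  · simp
  · rw [Finset.disjoint_map]
    refine Embedding.disjoint_rowDims hS ?_
    rintro rfl
    exact Finset.disjoint_left.1 hXY hx hy

/-- Take the last embedding tensor of `X` if there is one. Otherwise `X` holds data only, and a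
sketched edge of any of its tensors runs to an embedding tensor outside. -/
theorem exists_external (hS : S.net.IsGraph) (hrow : ∀ v, b ≤ S.rowSize ord v)
    (hsk : ∀ e ∈ P.sketched, b ≤ P.net.size e) (hv : ∀ v : VD, ∃ e ∈ P.sketched, v ∈ P.net.ends e)
    {X : Finset (VD ⊕ VE)} (hX : X.Nonempty) : ∃ F, IsExternal S ord X F ∧
      F ⊆ (P.combined S).edgesOut X ∧ b ≤ (∏ e ∈ F, (P.combined S).size e : ℕ) := by
  by_cases hr : X.toRight.Nonempty
  · obtain ⟨x, hx, hlast⟩ := Finset.exists_last ord hr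
    refine ⟨_, .inr ⟨x, Finset.mem_toRight.1 hx, rfl⟩, ?_, ?_⟩
    · intro e he
      obtain ⟨f, hf, rfl⟩ := Finset.mem_map.1 he
      exact rowDims_subset_edgesOut hS hx hlast hf
    · rw [Finset.prod_map]
      exact hrow x
  · rw [Finset.not_nonempty_iff_eq_empty] at hr
    have hno : ∀ x, Sum.inr x ∉ X := fun x hx => by
      simpa [hr] using Finset.mem_toRight.2 hx
    obtain ⟨v | x, hvX⟩ := hX
    · obtain ⟨e, he, hve⟩ := hv v
      refine ⟨_, .inl ⟨e, he, v, hvX, hve, rfl⟩, ?_, ?_⟩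
      · rw [Finset.singleton_subset_iff, mem_edgesOut]
        exact .inl ⟨⟨_, hvX, inl_mem_ends_inl.2 hve⟩, Sum.inr (S.attach ⟨e, he⟩), hno _,
          inr_mem_ends_inl.2 ⟨he, rfl⟩⟩
      · rw [Finset.prod_singleton]
        exact hsk e he
    · exact (hno x hvX).elim

/-- Contracting a data tensor costs at least the sizes of its dimensions and the external
dimensions of the other operand. -/
theorem le_contractionCost_tensor (hS : S.net.IsGraph) (hrow : ∀ v, b ≤ S.rowSize ord v)
    (hsk : ∀ e ∈ P.sketched, b ≤ P.net.size e) (hv : ∀ v : VD, ∃ e ∈ P.sketched, v ∈ P.net.ends e)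
    {A B : Finset (VD ⊕ VE)} (hAB : Disjoint A B) (hA : A.Nonempty) (hB : B.Nonempty) {v : VD}
    (h : A = {Sum.inl v} ∨ B = {Sum.inl v}) :
    b * P.tensorSize v ≤ (P.combined S).contractionCost A B := by
  have main : ∀ X : Finset (VD ⊕ VE), X.Nonempty → Disjoint {Sum.inl v} X → ∃ F,
      F ⊆ (P.combined S).edgesOut {Sum.inl v} ∪ (P.combined S).edgesOut X ∧
      b * P.tensorSize v ≤ (∏ e ∈ F, (P.combined S).size e : ℕ) := by
    intro X hX hd
    obtain ⟨F, hF, hsub, hb⟩ := exists_external (ord := ord) hS hrow hsk hv hX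
    refine ⟨F ∪ (Finset.univ.filter fun e => v ∈ P.net.ends e).map .inl,
      Finset.union_subset (hsub.trans Finset.subset_union_right) ?_, ?_⟩
    · intro e he
      obtain ⟨e, he', rfl⟩ := Finset.mem_map.1 he
      exact Finset.mem_union_left _ (inl_mem_edgesOut_singleton (Finset.mem_filter.1 he').2)
    · rw [Finset.prod_union, Finset.prod_map, Nat.cast_mul]
      · exact mul_le_mul_of_nonneg_right hb (Nat.cast_nonneg _)
      -- The external dimensions are not dimensions of `v`: a sketched edge has just one data end,
      -- here in `X`, and row dimensions are embedding edges.
      · rcases hF with ⟨e, he, u, huX, hue, rfl⟩ | ⟨x, hx, rfl⟩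
        · rw [Finset.disjoint_singleton_left]
          intro hmem
          obtain ⟨e', he', hee⟩ := Finset.mem_map.1 hmem
          obtain rfl : e' = e := Sum.inl_injective hee
          rw [eq_of_mem_ends_sketched he hue (Finset.mem_filter.1 he').2] at huX
          exact Finset.disjoint_left.1 hd (Finset.mem_singleton_self _) huX
        · exact (Finset.disjoint_map_inl_map_inr _ _).symm
  rcases h with rfl | rfl
  · obtain ⟨F, hF, hb⟩ := main B hB hAB
    exact hb.trans (le_contractionCost _ (combined_ends_nonempty hS) (combined_size_pos hS) hAB hF)
  · obtain ⟨F, hF, hb⟩ := main A hA hAB.symm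
    rw [Finset.union_comm] at hF
    exact hb.trans (le_contractionCost _ (combined_ends_nonempty hS) (combined_size_pos hS) hAB hF)

/-- Three disjoint groups of dimensions occur: an external one for each operand, worth `b` each, and
the unsketched data dimensions, which depend only on the data parts. -/
theorem le_contractionCost_contraction (hb : 0 ≤ b) (hS : S.net.IsGraph)
    (hrow : ∀ v, b ≤ S.rowSize ord v)
    (hsk : ∀ e ∈ P.sketched, b ≤ P.net.size e) (hv : ∀ v : VD, ∃ e ∈ P.sketched, v ∈ P.net.ends e)
    {A B : Finset (VD ⊕ VE)} (hAB : Disjoint A B) (hA : A.Nonempty) (hB : B.Nonempty) :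
    b ^ 2 * P.unsketchedSize A.toLeft B.toLeft ≤ (P.combined S).contractionCost A B := by
  obtain ⟨F, hF, hsub, hbF⟩ := exists_external (ord := ord) hS hrow hsk hv hA
  obtain ⟨F', hF', hsub', hbF'⟩ := exists_external (ord := ord) hS hrow hsk hv hB
  have hext : ∀ {X F}, IsExternal S ord X F → Disjoint F
      (((P.net.edgesOut A.toLeft ∪ P.net.edgesOut B.toLeft) \ P.sketched).map .inl) := by
    rintro X F (⟨e, he, u, huX, hue, rfl⟩ | ⟨x, hx, rfl⟩)
    · rw [Finset.disjoint_singleton_left]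
      intro hmem
      obtain ⟨e', he', hee⟩ := Finset.mem_map.1 hmem
      obtain rfl : e' = e := Sum.inl_injective hee
      exact (Finset.mem_sdiff.1 he').2 he
    · exact (Finset.disjoint_map_inl_map_inr _ _).symm
  refine le_trans ?_ (le_contractionCost _ (combined_ends_nonempty hS) (combined_size_pos hS) hAB
    (F := F ∪ F' ∪ ((P.net.edgesOut A.toLeft ∪ P.net.edgesOut B.toLeft) \ P.sketched).map .inl) ?_)
  · rw [Finset.prod_union (Finset.disjoint_union_left.2 ⟨hext hF, hext hF'⟩),
      Finset.prod_union (hF.disjoint hS hAB hF'), Finset.prod_map, Nat.cast_mul, Nat.cast_mul, sq]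
    exact mul_le_mul_of_nonneg_right (mul_le_mul hbF hbF' hb (Nat.cast_nonneg _))
      (Nat.cast_nonneg _)
  · refine Finset.union_subset (Finset.union_subset_union hsub hsub') fun e he => ?_
    obtain ⟨e, he', rfl⟩ := Finset.mem_map.1 he
    rw [Finset.mem_sdiff, Finset.mem_union] at he'
    exact Finset.mem_union.2 (he'.1.imp (inl_mem_edgesOut_of_not_sketched he'.2).2
      (inl_mem_edgesOut_of_not_sketched he'.2).2)

theorem unsketchedSize_comm (A B : Finset VD) : P.unsketchedSize A B = P.unsketchedSize B A := by
  rw [unsketchedSize, unsketchedSize, Finset.union_comm]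

variable {TB : ContractionTree (VD ⊕ VE)}

theorem cost_eq_sum (hTB : TB.IsFull) (G : TensorNetwork (VD ⊕ VE) (ED ⊕ EE)) :
    TB.cost G = ∑ q ∈ TB.contractions.toFinset, G.contractionCost q.1 q.2 := by
  rw [cost, List.sum_toFinset _ (nodup_contractions hTB.nodup)]

theorem contractionCost_nonneg (G : TensorNetwork (VD ⊕ VE) (ED ⊕ EE))
    (A B : Finset (VD ⊕ VE)) : 0 ≤ G.contractionCost A B := (Real.exp_pos _).le

/-- The data parts of the matching contraction recover the union of `p`, hence `p`. So distinct
contractions of `P.tree` are charged to distinct contractions of `TB`. -/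
theorem sum_contractions_le_cost (hb : 0 ≤ b) (hS : S.net.IsGraph)
    (hrow : ∀ v, b ≤ S.rowSize ord v)
    (hsk : ∀ e ∈ P.sketched, b ≤ P.net.size e) (hv : ∀ v : VD, ∃ e ∈ P.sketched, v ∈ P.net.ends e)
    (hTB : TB.IsFull) (hcon : TB.ConstrainedOn P.tree) :
    ∑ p ∈ P.tree.contractions.toFinset, b ^ 2 * (P.unsketchedSize p.1 p.2 : ℝ) ≤
      TB.cost (P.combined S) := by
  choose! q hq hpq using hcon
  have hinj : Set.InjOn q P.tree.contractions.toFinset := by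
    intro p hp p' hp' h
    rw [Finset.mem_coe, List.mem_toFinset] at hp hp'
    refine contraction_eq_of_union_eq P.tree_full.nodup hp hp' ?_
    have hu : ∀ p ∈ P.tree.contractions, p.1 ∪ p.2 = (q p).1.toLeft ∪ (q p).2.toLeft := by
      intro p hp
      rcases hpq p hp with ⟨h₁, h₂⟩ | ⟨h₁, h₂⟩
      · rw [h₁, h₂]
      · rw [h₁, h₂, Finset.union_comm]
    rw [hu p hp, hu p' hp', h]
  have hcost : ∀ p ∈ P.tree.contractions, b ^ 2 * (P.unsketchedSize p.1 p.2 : ℝ) ≤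
      (P.combined S).contractionCost (q p).1 (q p).2 := by
    intro p hp
    have := le_contractionCost_contraction hb hS hrow hsk hv
      (disjoint_of_mem_contractions hTB.nodup (hq p hp))
      (nonempty_of_mem_nodes (fst_mem_nodes (hq p hp)))
      (nonempty_of_mem_nodes (snd_mem_nodes (hq p hp)))
    rcases hpq p hp with ⟨h₁, h₂⟩ | ⟨h₁, h₂⟩
    · rwa [h₁, h₂] at this
    · rwa [h₁, h₂, unsketchedSize_comm] at this
  rw [cost_eq_sum hTB]
  refine (Finset.sum_le_sum fun p hp => hcost p (List.mem_toFinset.1 hp)).trans ?_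
  rw [← Finset.sum_image (f := fun r => (P.combined S).contractionCost r.1 r.2) hinj]
  refine Finset.sum_le_sum_of_subset_of_nonneg ?_ fun _ _ _ => contractionCost_nonneg _ _ _
  intro r hr
  obtain ⟨p, hp, rfl⟩ := Finset.mem_image.1 hr
  exact List.mem_toFinset.2 (hq p (List.mem_toFinset.1 hp))

/-- An embedding tensor exists, so the leaf is not the root and has a parent. -/
theorem exists_contraction_tensor [Nonempty VE] (hTB : TB.IsFull) (v : VD) :
    ∃ q ∈ TB.contractions, q.1 = {Sum.inl v} ∨ q.2 = {Sum.inl v} := by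
  have hne : ({Sum.inl v} : Finset (VD ⊕ VE)) ≠ TB.verts := fun h => by
    obtain ⟨x⟩ := ‹Nonempty VE›
    have : Sum.inr x ∈ ({Sum.inl v} : Finset (VD ⊕ VE)) := by
      rw [h, hTB.verts_eq]; exact Finset.mem_univ _
    simp at this
  obtain ⟨X, q, hq, h, -⟩ := exists_isParent (singleton_mem_nodes (hTB.mem_leaves (Sum.inl v))) hne
  exact ⟨q, hq, h⟩

theorem sum_tensors_le_cost [Nonempty VE] (hS : S.net.IsGraph) (hrow : ∀ v, b ≤ S.rowSize ord v)
    (hsk : ∀ e ∈ P.sketched, b ≤ P.net.size e) (hv : ∀ v : VD, ∃ e ∈ P.sketched, v ∈ P.net.ends e)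
    (hTB : TB.IsFull) :
    ∑ v, b * (P.tensorSize v : ℝ) ≤ 2 * TB.cost (P.combined S) := by
  classical
  choose q hq hqv using exists_contraction_tensor (TB := TB) hTB
  have hcost : ∀ v, b * (P.tensorSize v : ℝ) ≤
      (P.combined S).contractionCost (q v).1 (q v).2 := fun v =>
    le_contractionCost_tensor hS hrow hsk hv (disjoint_of_mem_contractions hTB.nodup (hq v))
      (nonempty_of_mem_nodes (fst_mem_nodes (hq v)))
      (nonempty_of_mem_nodes (snd_mem_nodes (hq v))) (hqv v)
  have hpart : ∀ s : Finset VD, Set.InjOn q s → ∑ v ∈ s, b * (P.tensorSize v : ℝ) ≤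
      TB.cost (P.combined S) := by
    intro s hs
    rw [cost_eq_sum hTB]
    refine (Finset.sum_le_sum fun v _ => hcost v).trans ?_
    rw [← Finset.sum_image (f := fun r => (P.combined S).contractionCost r.1 r.2) hs]
    refine Finset.sum_le_sum_of_subset_of_nonneg ?_ fun _ _ _ => contractionCost_nonneg _ _ _
    intro r hr
    obtain ⟨v, -, rfl⟩ := Finset.mem_image.1 hr
    exact List.mem_toFinset.2 (hq v)
  -- Split the data tensors by the side on which they are consumed. On each side the operand
  -- determines the tensor, so each half is at most the cost.
  rw [← Finset.sum_filter_add_sum_filter_not _ fun v => (q v).1 = {Sum.inl v}, two_mul]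
  refine add_le_add (hpart _ ?_) (hpart _ ?_)
  · intro u hu v hv h
    rw [Finset.mem_coe, Finset.mem_filter] at hu hv
    have := hu.2.symm.trans ((congrArg Prod.fst h).trans hv.2)
    exact Sum.inl_injective (Finset.singleton_injective this)
  · intro u hu v hv h
    rw [Finset.mem_coe, Finset.mem_filter] at hu hv
    have := ((hqv u).resolve_left hu.2).symm.trans
      ((congrArg Prod.snd h).trans ((hqv v).resolve_left hv.2))
    exact Sum.inl_injective (Finset.singleton_injective this)

/-- The tree embedding is optimal up to a constant among embeddings whose matricized tensors
have row sizes comparable to `m`. -/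
theorem treeSketch_cost_le [Nonempty VE] {m : ℕ} {κ : ℝ} (hm : 1 ≤ m) (hκ : 0 < κ) (hκ₁ : κ ≤ 1)
    (hS : S.net.IsGraph) (hrow : ∀ v, κ * m ≤ S.rowSize ord v)
    (hsk : ∀ e ∈ P.sketched, m < P.net.size e) (hv : ∀ v : VD, ∃ e ∈ P.sketched, v ∈ P.net.ends e)
    (hmp : ∀ p ∈ P.tree.contractions, m ≤ P.net.contractedSize p.1 p.2)
    (hTB : TB.IsFull) (hcon : TB.ConstrainedOn P.tree) :
    P.treeSketch.cost (P.combined (P.treeEmbedding m)) ≤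
      (2 / κ + 2 / κ ^ 2) * TB.cost (P.combined S) := by
  have hsk' : ∀ e ∈ P.sketched, κ * m ≤ P.net.size e := fun e he => by
    have : (m : ℝ) ≤ P.net.size e := by exact_mod_cast (hsk e he).le
    exact (mul_le_of_le_one_left (Nat.cast_nonneg m) hκ₁).trans this
  have h₁ := sum_tensors_le_cost hS hrow hsk' hv hTB
  have h₂ := sum_contractions_le_cost (by positivity) hS hrow hsk' hv hTB hcon
  have h₃ := sketch_cost_le hm hmp P.tree_full.nodup (fun _ h => h) (List.Subset.refl _)
  rw [← List.sum_toFinset _ P.tree_full.nodup,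
    ← List.sum_toFinset _ (nodup_contractions P.tree_full.nodup),
    Finset.eq_univ_of_forall fun v => List.mem_toFinset.2 (P.tree_full.mem_leaves v)] at h₃
  refine h₃.trans ?_
  rw [← Finset.mul_sum] at h₁ h₂
  rw [← Finset.mul_sum, ← Finset.mul_sum, ← Finset.mul_sum, add_mul]
  -- With `b = κ * m`, the tensor sum is `1 / κ` times one bounded by twice the cost, and the
  -- contraction sum is `2 / κ ^ 2` times one bounded by the cost.
  refine add_le_add ?_ ?_
  · rw [div_mul_eq_mul_div, le_div_iff₀ hκ]
    linarith
  · rw [div_mul_eq_mul_div, le_div_iff₀ (by positivity)]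
    nlinarith

end SketchingInput

/-! ### Choice of constants and conclusion -/

theorem Embedding.IsAdmissible.nonempty {ED VE EE : Type*} {sketched : Finset ED} [Fintype VE]
    [DecidableEq VE] [Fintype EE] [DecidableEq EE] {S : Embedding sketched VE EE}
    {c₀ c₁ c₂ ε δ : ℝ} (hS : S.IsAdmissible c₀ c₁ c₂ ε δ) : Nonempty VE := by
  obtain ⟨f, hf⟩ := Finset.card_eq_one.1 hS.one_output
  have hf' : f ∈ S.net.uncontracted := hf ▸ Finset.mem_singleton_self f
  obtain ⟨x, -⟩ := Finset.card_eq_one.1 (hS.graph.card_uncontracted f hf')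
  exact ⟨x⟩

theorem theorem4p4 (c₀ c₁ c₂ : ℝ) (hc₀ : 0 < c₀) (hc₀₁ : c₀ ≤ c₁) (hc₁₂ : c₁ ≤ c₂) :
    ∃ C : ℝ, 0 < C ∧
      ∀ (VD ED : Type*) [Fintype VD] [DecidableEq VD] [Fintype ED] [DecidableEq ED]
        (P : SketchingInput VD ED) (ε δ : ℝ) (m : ℕ),
        0 < ε → 0 < δ → δ < 1 →
        -- the sketch size of the tree embedding, which has `2 N - 1` tensors
        c₁ * ((2 * Fintype.card VD - 1) * (Real.log (1 / δ) / ε ^ 2)) ≤ m →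
        m ≤ c₂ * ((2 * Fintype.card VD - 1) * (Real.log (1 / δ) / ε ^ 2)) →
        -- each dimension to be sketched is larger than the sketch size
        (∀ e ∈ P.sketched, m < P.net.size e) →
        -- each data tensor is adjacent to an edge to be sketched
        (∀ v : VD, ∃ e ∈ P.sketched, v ∈ P.net.ends e) →
        -- each contraction of the data tree contracts dimensions of total size at least `m`
        (∀ p ∈ P.tree.contractions, m ≤ P.net.contractedSize p.1 p.2) →
        -- the tree embedding and its contraction tree are feasible
        (Fintype.card P.TreeNode = 2 * Fintype.card VD - 1 ∧
          (P.treeEmbedding m).IsTree ∧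
          (P.treeEmbedding m).IsAdmissible c₀ c₁ c₂ ε δ ∧
          (P.treeEmbedding m).sketchSize = m ∧
          P.treeSketch.IsFull ∧
          P.treeSketch.ConstrainedOn P.tree) ∧
        -- and their cost is optimal up to the factor `C`
        ∀ (VE EE : Type*) [Fintype VE] [DecidableEq VE] [Fintype EE] [DecidableEq EE]
          (S : Embedding P.sketched VE EE) (TB : ContractionTree (VD ⊕ VE)),
          S.IsAdmissible c₀ c₁ c₂ ε δ →
          c₁ * (Fintype.card VD * (Real.log (1 / δ) / ε ^ 2)) ≤ S.sketchSize →
          TB.IsFull →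
          TB.ConstrainedOn P.tree →
          P.treeSketch.cost (P.combined (P.treeEmbedding m)) ≤ C * TB.cost (P.combined S) := by
  have hc₁ : 0 < c₁ := hc₀.trans_le hc₀₁
  have hc₂ : 0 < c₂ := hc₁.trans_le hc₁₂
  -- This is κ. The sketch size lies between c₁NK and c₂N_E K, so N_E ≥ (c₁/c₂)N. As m ≤ 2c₂NK, the
  -- row bound c₀N_E K is at least κm.
  have hκ : 0 < c₀ * c₁ / (2 * c₂ ^ 2) := by positivity
  refine ⟨2 / (c₀ * c₁ / (2 * c₂ ^ 2)) + 2 / (c₀ * c₁ / (2 * c₂ ^ 2)) ^ 2, by positivity, ?_⟩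
  intro VD ED _ _ _ _ P ε δ m hε hδ hδ₁ h₁ h₂ hsk hv hmp
  have hK : 0 < Real.log (1 / δ) / ε ^ 2 :=
    div_pos (Real.log_pos (by rw [one_div]; exact (one_lt_inv₀ hδ).2 hδ₁)) (by positivity)
  have hcard := SketchingInput.card_treeNode (P := P)
  have hN : (1 : ℝ) ≤ Fintype.card VD := by
    exact_mod_cast (by omega : 1 ≤ Fintype.card VD)
  have hm : 1 ≤ m := by
    have : (0 : ℝ) < m :=
      lt_of_lt_of_le (mul_pos hc₁ (mul_pos (by linarith) hK)) h₁
    exact_mod_cast this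
  refine ⟨⟨by omega, SketchingInput.isTree_treeEmbedding hm,
    SketchingInput.isAdmissible_treeEmbedding hm hc₀₁ hK.le h₁ h₂,
    SketchingInput.sketchSize_treeEmbedding, SketchingInput.isFull_treeSketch,
    ContractionTree.sketch_constrainedOn⟩, ?_⟩
  intro VE EE _ _ _ _ S TB hS hsize hTB hcon
  obtain ⟨ord, hord⟩ := hS.linearization
  have := hS.nonempty
  refine SketchingInput.treeSketch_cost_le hm hκ ?_ hS.graph (ord := ord) (fun v => ?_) hsk hv
    hmp hTB hcon
  -- κ ≤ 1, because c₀ and c₁ are at most c₂; thus sketched dimensions larger than m also exceed κm.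
  · rw [div_le_one (by positivity)]
    nlinarith [mul_le_mul (hc₀₁.trans hc₁₂) hc₁₂ hc₁.le hc₂.le]
  · refine le_trans ?_ (hord v)
    have hup := hsize.trans hS.sketchSize_le
    generalize Real.log (1 / δ) / ε ^ 2 = K at *
    have hmK : (m : ℝ) ≤ 2 * c₂ * (Fintype.card VD * K) := by
      refine h₂.trans ?_
      have := mul_pos hc₂ hK
      nlinarith
    rw [div_mul_eq_mul_div, div_le_iff₀ (by positivity)]
    calc c₀ * c₁ * m ≤ c₀ * c₁ * (2 * c₂ * (Fintype.card VD * K)) := by gcongr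
      _ = c₀ * (2 * c₂) * (c₁ * (Fintype.card VD * K)) := by ring
      _ ≤ c₀ * (2 * c₂) * (c₂ * (Fintype.card VE * K)) := by gcongr
      _ = _ := by ring
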